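/- Let $X_1,X_2,\dots$ be iid random variables with $\mathbb E[X_1]=0$ and $\mathbb E[X_1^2]=1$, let $S_0=0$, $S_n=X_1+\cdots+X_n$, and let $(S_n^{(i)})_{n\ge 0}$, $i=1,2,\dots$, be iid copies of the random walk $(S_n)_{n\ge 0}$. Let $p=p_n$ be a sequence of integers with $p_n\to\infty$ as $n\to\infty$. Let $\overline\Phi=1-\Phi$ be the standard normal right tail and $$d_p=\sqrt{2\log p}-\frac{\log\log p+\log 4\pi}{2(2\log p)^{1/2}}.$$ Let $(E_i)_{i\ge1}$ be iid standard exponential random variables, $\Gamma_i=E_1+\cdots+E_i$, and write $\varepsilon_x$ for the Dirac measure at $x$. Then the following three statements are equivalent as $n\to\infty$: (a) for every $x\in\mathbb R$, $\; p\,\mathbb P\big(S_n/\sqrt n>d_p+x/d_p\big)\sim p\,\overline\Phi(d_p+x/d_p)\to e^{-x}$; (b) for every $x\in\mathbb R$, $\; \mathbb P\Big(d_p\max_{i=1,\dots,p}\big(S_n^{(i)}/\sqrt n-d_p\big)\le x\Big)\to \exp(-e^{-x})$; (c) $N_n=\sum_{i=1}^{p}\varepsilon_{d_p(S_n^{(i)}/\sqrt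 n-d_p)}$ converges in distribution to $N=\sum_{i=1}^\infty\varepsilon_{-\log\Gamma_i}$, as random elements of the space of point measures on the state space $(-\infty,\infty]$ (measures finite on compact sets with values in $\{0,1,2,\dots,\infty\}$) with the vague topology. Moreover, $N$ is a Poisson random measure on $(-\infty,\infty]$ whose mean measure $\mu$ is given by $\mu(x,\infty]=e^{-x}$ for $x\in\mathbb R$, with no mass at $\infty$. -/

import Mathlib

open MeasureTheory ProbabilityTheory Filter Topology

noncomputable section

/-! ### Normalization, Gaussian tail, random walks -/

/-- `d_p = √(2 log p) - (log log p + log 4π) / (2 (2 log p)^{1/2})`. -/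
def gumbelNorm (p : ℕ) : ℝ :=
  Real.sqrt (2 * Real.log p)
    - (Real.log (Real.log p) + Real.log (4 * Real.pi)) / (2 * Real.sqrt (2 * Real.log p))

/-- The standard normal right tail `1 - Φ(y)`. -/
def normalTail (y : ℝ) : ℝ := 1 - cdf (gaussianReal 0 1) y

/-- The partial sums `S_n = X_1 + ⋯ + X_n` (the sequence `X` is indexed from `0`). -/
def partialSum {Ω : Type*} (X : ℕ → Ω → ℝ) (n : ℕ) (ω : Ω) : ℝ :=
  ∑ t ∈ Finset.range n, X t ω

/-! ### Point measures and the vague topology -/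

/-- A measure is a point measure if it is finite on compact sets and takes values in
`{0, 1, 2, …, ∞}`. -/
def IsPointMeasure {E : Type*} [TopologicalSpace E] [MeasurableSpace E] (m : Measure E) : Prop :=
  (∀ K : Set E, IsCompact K → m K < ⊤) ∧
    ∀ B : Set E, MeasurableSet B → ∃ k : ℕ∞, m B = (k : ENNReal)

/-- The space `M_p(E)` of point measures on `E`. -/
structure PointMeasure (E : Type*) [TopologicalSpace E] [MeasurableSpace E] where
  toMeasure : Measure E
  isPointMeasure : IsPointMeasure toMeasure

/-- The vague topology on `M_p(E)`: the coarsest topology for which `m ↦ ∫ f dm` is continuous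
for every continuous compactly supported `f : E → ℝ`. -/
instance PointMeasure.instTopologicalSpace (E : Type*) [TopologicalSpace E] [MeasurableSpace E] :
    TopologicalSpace (PointMeasure E) :=
  TopologicalSpace.induced
    (fun (m : PointMeasure E) (f : CompactlySupportedContinuousMap E ℝ) => ∫ x, f x ∂m.toMeasure)
    inferInstance

instance PointMeasure.instMeasurableSpace (E : Type*) [TopologicalSpace E] [MeasurableSpace E] :
    MeasurableSpace (PointMeasure E) :=
  borel (PointMeasure E)

instance PointMeasure.instBorelSpace (E : Type*) [TopologicalSpace E] [MeasurableSpace E] :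
    BorelSpace (PointMeasure E) :=
  ⟨rfl⟩

theorem isPointMeasure_zero (E : Type*) [TopologicalSpace E] [MeasurableSpace E] :
    IsPointMeasure (0 : Measure E) :=
  ⟨fun K _ => by simp, fun B _ => ⟨0, by simp⟩⟩

open Classical in
/-- The point measure `∑ᵢ ε_{xᵢ}` of a countable family of points. If the points accumulate, so
that the sum is not a point measure, the value is the zero measure; this does not happen for a
finite family, and for the limit process below it happens with probability zero only. -/
def sumDirac {ι E : Type*} [TopologicalSpace E] [MeasurableSpace E] (x : ι → E) :
    PointMeasure E :=
  if h : IsPointMeasure (Measure.sum fun i => Measure.dirac (x i)) then ⟨_, h⟩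
  else ⟨0, isPointMeasure_zero E⟩

theorem isPointMeasure_sum_dirac {ι E : Type*} [Finite ι] [TopologicalSpace E]
    [MeasurableSpace E] (x : ι → E) :
    IsPointMeasure (Measure.sum fun i => Measure.dirac (x i)) := by
  classical
  have := Fintype.ofFinite ι
  constructor
  · intro K _
    rw [Measure.sum_fintype]
    exact measure_lt_top _ _
  · intro B hB
    refine ⟨((Finset.univ.filter fun i => x i ∈ B).card : ℕ), ?_⟩
    rw [Measure.sum_apply _ hB, tsum_fintype]
    simp [Measure.dirac_apply' _ hB, Set.indicator_apply]

theorem sumDirac_toMeasure_of_finite {ι E : Type*} [Finite ι] [TopologicalSpace E]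
    [MeasurableSpace E] (x : ι → E) :
    (sumDirac x).toMeasure = Measure.sum fun i => Measure.dirac (x i) := by
  rw [sumDirac, dif_pos (isPointMeasure_sum_dirac x)]

/-- `N` is a Poisson random measure with mean measure `m`: `N(B)` has the Poisson distribution
with parameter `m(B)` if `m(B) < ∞` and is almost surely infinite if `m(B) = ∞`, and the values
of `N` on finitely many disjoint sets are independent. -/
structure IsPoissonRandomMeasure {Ω E : Type*} [MeasurableSpace Ω] [TopologicalSpace E]
    [MeasurableSpace E] (N : Ω → PointMeasure E) (m : Measure E) (P : Measure Ω) : Prop where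
  hasLaw_of_lt_top : ∀ B : Set E, MeasurableSet B → m B < ⊤ →
    HasLaw (fun ω => (N ω).toMeasure B) ((poissonMeasure (m B).toNNReal).map (Nat.cast : ℕ → ENNReal)) P
  ae_eq_top : ∀ B : Set E, MeasurableSet B → m B = ⊤ → ∀ᵐ ω ∂P, (N ω).toMeasure B = ⊤
  iIndepFun_of_disjoint : ∀ (k : ℕ) (B : Fin k → Set E), (∀ j, MeasurableSet (B j)) →
    Pairwise (fun i j => Disjoint (B i) (B j)) → iIndepFun (fun j ω => (N ω).toMeasure (B j)) P

/-! ### The state space `(-∞, ∞]` -/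

/-- The state space `(-∞, ∞]`, in which the closed neighbourhoods `[x, ∞]` of `∞` are compact. -/
abbrev UpperReal : Type := Set.Ioi (⊥ : EReal)

def toUpperReal (x : ℝ) : UpperReal := ⟨(x : EReal), EReal.bot_lt_coe x⟩

/-- The measure `e^{-x} dx` on `ℝ`, regarded as a measure on `(-∞, ∞]` without mass at `∞`. -/
def expIntensity : Measure UpperReal :=
  (volume.withDensity fun x : ℝ => ENNReal.ofReal (Real.exp (-x))).map toUpperReal

theorem measurable_toUpperReal : Measurable toUpperReal :=
  measurable_coe_real_ereal.subtype_mk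

/-- The mean measure satisfies `μ(x, ∞] = e^{-x}`. -/
theorem expIntensity_Ioi (x : ℝ) :
    expIntensity (Set.Ioi (toUpperReal x)) = ENNReal.ofReal (Real.exp (-x)) := by
  have hpre : toUpperReal ⁻¹' Set.Ioi (toUpperReal x) = Set.Ioi x := by
    ext y
    exact EReal.coe_lt_coe_iff
  rw [expIntensity, Measure.map_apply measurable_toUpperReal measurableSet_Ioi, hpre,
    withDensity_apply _ measurableSet_Ioi,
    ← ofReal_integral_eq_lintegral_ofReal (integrableOn_exp_neg_Ioi x)
      (Filter.Eventually.of_forall fun y => (Real.exp_pos _).le), integral_exp_neg_Ioi]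

/-! ### The three limit relations -/

/-- `p P(S_n/√n > d_p + x/d_p) ∼ p (1 - Φ(d_p + x/d_p)) → e^{-x}` for all real `x`. -/
def TailRelation {Ω : Type*} [MeasurableSpace Ω] (P : Measure Ω) (X : ℕ → Ω → ℝ)
    (p : ℕ → ℕ) : Prop :=
  ∀ x : ℝ,
    Asymptotics.IsEquivalent atTop
      (fun n => (p n : ℝ) * P.real {ω | partialSum X n ω / Real.sqrt n
        > gumbelNorm (p n) + x / gumbelNorm (p n)})
      (fun n => (p n : ℝ) * normalTail (gumbelNorm (p n) + x / gumbelNorm (p n))) ∧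
    Tendsto (fun n => (p n : ℝ) * normalTail (gumbelNorm (p n) + x / gumbelNorm (p n)))
      atTop (𝓝 (Real.exp (-x)))

/-- `P(d_p max_{i ≤ p} (S_n^{(i)}/√n - d_p) ≤ x) → exp(-e^{-x})` for all real `x`. -/
def MaxConvergesToGumbel {Ω : Type*} [MeasurableSpace Ω] (P : Measure Ω)
    (S : ℕ → ℕ → Ω → ℝ) (p : ℕ → ℕ) : Prop :=
  ∀ x : ℝ,
    Tendsto
      (fun n => P.real {ω | gumbelNorm (p n) *
        (⨆ i : Fin (p n), (S i n ω / Real.sqrt n - gumbelNorm (p n))) ≤ x})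
      atTop (𝓝 (Real.exp (-Real.exp (-x))))

/-- The point process `N_n = ∑_{i ≤ p} ε_{d_p (S_n^{(i)}/√n - d_p)}`. -/
def walkPointProcess {Ω : Type*} (S : ℕ → ℕ → Ω → ℝ) (p : ℕ → ℕ) (n : ℕ) (ω : Ω) :
    PointMeasure UpperReal :=
  sumDirac fun i : Fin (p n) =>
    toUpperReal (gumbelNorm (p n) * (S i n ω / Real.sqrt n - gumbelNorm (p n)))

/-- The point process `N = ∑_{i ≥ 1} ε_{-log Γ_i}` with `Γ_i = E_1 + ⋯ + E_i`. -/
def limitPointProcess {Ω : Type*} (E : ℕ → Ω → ℝ) (ω : Ω) : PointMeasure UpperReal :=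
  sumDirac fun i : ℕ => toUpperReal (-Real.log (partialSum E (i + 1) ω))

end

noncomputable section

/-! ### The Gaussian tail -/

/-! The Gaussian half of (a) always holds: by the Mills ratio and the choice of `gumbelNorm`, `p *
normalTail` tends to `exp (-x)` (`tendsto_mul_normalTail`). Hence (a) says only that `p` times the
tail of one normalized walk at `x` tends to `exp (-x)` (`tailRelation_iff`), a statement about the
intensity of the point process on half-lines.

The limit process is handled through the functional `expTail g s = exp (-∫ₛ^∞ (1 - g))`. It solves
the renewal equation of exponential spacings (`integral_mul_expTail`). Iterating this along the
partial sums `Γ_n → ∞` gives `E ∏ g(Γ_i) = exp (-∫₀^∞ (1 - g))`. The map `-log` carries Lebesgue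
measure on `(0, ∞)` to `expIntensity`, so exponentials of indicators in place of `g` give the joint
characteristic functions of the counts, and from them the Poisson laws and independence.

(a) ⇒ (c): the joint characteristic function of the counts of `p` iid points in half-lines is a
`p`-th power `(1 + a_n)^p`. Expanding the character into indicators of half-lines shows that `p *
a_n` converges (`tendsto_pow_integral_indicatorChar`). The counts on rational half-lines are
integers and determine vague neighbourhoods, so each vaguely open set is an increasing union of
finite-dimensional open cylinders (`exists_isOpen_eq_iUnion_preimage`). Convergence of the count
vectors therefore gives the portmanteau inequality for open sets.

(c) ⇒ (b): the maximum is at most `x` exactly when there is no point in `(x, ∞]`, and void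
probabilities converge by a sandwich between continuous functionals
(`tendsto_void_of_tendstoInDistribution`).

(b) ⇒ (a): by independence the void probability is `(1 - q)^p`, and its limit determines that of `p
* q` (`tendsto_mul_of_tendsto_one_sub_pow`). -/

theorem hasDerivAt_normalTail (y : ℝ) :
    HasDerivAt normalTail (-gaussianPDFReal 0 1 y) y := by
  have hint : Integrable (gaussianPDFReal 0 1) := integrable_gaussianPDFReal 0 1
  have hcont : Continuous (gaussianPDFReal 0 1) := by
    rw [gaussianPDFReal_def]; fun_prop
  have hcdf : ∀ u, cdf (gaussianReal 0 1) u = ∫ t in Set.Iic u, gaussianPDFReal 0 1 t := by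
    intro u
    rw [cdf_eq_real, Measure.real, gaussianReal_apply_eq_integral 0 one_ne_zero,
      ENNReal.toReal_ofReal (integral_nonneg fun t => gaussianPDFReal_nonneg 0 1 t)]
  have heq : normalTail = fun u => (1 - ∫ t in Set.Iic 0, gaussianPDFReal 0 1 t)
      - ∫ t in (0 : ℝ)..u, gaussianPDFReal 0 1 t := by
    funext u
    rw [← intervalIntegral.integral_Iic_sub_Iic hint.integrableOn hint.integrableOn, normalTail,
      hcdf]
    ring
  rw [heq]
  exact (intervalIntegral.integral_hasDerivAt_right hint.intervalIntegrable
    hcont.stronglyMeasurable.stronglyMeasurableAtFilter hcont.continuousAt).const_sub _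

theorem gaussianPDFReal_zero_one (u : ℝ) :
    gaussianPDFReal 0 1 u = (√(2 * Real.pi))⁻¹ * Real.exp (-u ^ 2 / 2) := by
  simp [gaussianPDFReal_def]

theorem tendsto_normalTail_atTop : Tendsto normalTail atTop (𝓝 0) := by
  have := (tendsto_cdf_atTop (gaussianReal 0 1)).const_sub 1
  rwa [sub_self] at this

/-- L'Hôpital: with `φ` the density, `φ(u)/u` has derivative `-φ(u) (1 + u⁻²)`, so the quotient of
the derivatives is `(1 + u⁻²)⁻¹`. -/
theorem tendsto_normalTail_div_atTop :
    Tendsto (fun u => normalTail u / (gaussianPDFReal 0 1 u * u⁻¹)) atTop (𝓝 1) := by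
  have hpos : ∀ u, 0 < gaussianPDFReal 0 1 u := fun u => gaussianPDFReal_pos 0 1 u one_ne_zero
  have hpdf : ∀ u, HasDerivAt (gaussianPDFReal 0 1) (-u * gaussianPDFReal 0 1 u) u := by
    intro u
    have h : HasDerivAt (fun u : ℝ => (√(2 * Real.pi))⁻¹ * Real.exp (-u ^ 2 / 2))
        ((√(2 * Real.pi))⁻¹ * (Real.exp (-u ^ 2 / 2) * (-(2 * u) / 2))) u := by
      have h1 : HasDerivAt (fun u : ℝ => -u ^ 2 / 2) (-(2 * u) / 2) u := by
        simpa using ((hasDerivAt_pow 2 u).neg.div_const 2)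
      exact h1.exp.const_mul _
    rw [show gaussianPDFReal 0 1 = fun u : ℝ => (√(2 * Real.pi))⁻¹ * Real.exp (-u ^ 2 / 2) from
      funext gaussianPDFReal_zero_one]
    convert h using 1
    ring
  refine HasDerivAt.lhopital_zero_atTop (f' := fun u => -gaussianPDFReal 0 1 u)
    (g' := fun u => -u * gaussianPDFReal 0 1 u * u⁻¹ + gaussianPDFReal 0 1 u * (-(u ^ 2)⁻¹))
    (Eventually.of_forall hasDerivAt_normalTail) ?_ ?_ tendsto_normalTail_atTop ?_ ?_
  · filter_upwards [eventually_gt_atTop 0] with u hu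
    exact (hpdf u).mul (hasDerivAt_inv hu.ne')
  · filter_upwards [eventually_gt_atTop 0] with u hu
    have h1 : -u * gaussianPDFReal 0 1 u * u⁻¹ = -gaussianPDFReal 0 1 u := by field_simp
    have h2 : 0 < gaussianPDFReal 0 1 u * (u ^ 2)⁻¹ := mul_pos (hpos u) (by positivity)
    rw [h1]
    have := hpos u
    intro h
    linarith
  · have h1 : Tendsto (fun u => normalTail u) atTop (𝓝 0) := tendsto_normalTail_atTop
    have hle : ∀ u, gaussianPDFReal 0 1 u ≤ (√(2 * Real.pi))⁻¹ := by
      intro u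
      rw [gaussianPDFReal_zero_one]
      refine mul_le_of_le_one_right (by positivity) (Real.exp_le_one_iff.2 ?_)
      nlinarith [sq_nonneg u]
    have h2 : Tendsto (fun u : ℝ => (√(2 * Real.pi))⁻¹ * u⁻¹) atTop (𝓝 0) := by
      simpa using tendsto_inv_atTop_zero.const_mul (√(2 * Real.pi))⁻¹
    refine squeeze_zero' ?_ ?_ h2
    · filter_upwards [eventually_gt_atTop 0] with u hu
      exact (mul_pos (hpos u) (inv_pos.2 hu)).le
    · filter_upwards [eventually_gt_atTop 0] with u hu
      exact mul_le_mul_of_nonneg_right (hle u) (inv_pos.2 hu).le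
  · have h3 : Tendsto (fun u : ℝ => (1 + (u ^ 2)⁻¹)⁻¹) atTop (𝓝 1) := by
      have : Tendsto (fun u : ℝ => (u ^ 2)⁻¹) atTop (𝓝 0) :=
        tendsto_inv_atTop_zero.comp (tendsto_pow_atTop two_ne_zero)
      simpa using (this.const_add 1).inv₀ (by simp)
    refine h3.congr' ?_
    filter_upwards [eventually_gt_atTop 0] with u hu
    have := hpos u
    have h1 : -u * gaussianPDFReal 0 1 u * u⁻¹ = -gaussianPDFReal 0 1 u := by field_simp
    have h4 : -gaussianPDFReal 0 1 u + gaussianPDFReal 0 1 u * -(u ^ 2)⁻¹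
      = -gaussianPDFReal 0 1 u * (1 + (u ^ 2)⁻¹) := by ring
    rw [h1, h4, ← div_div, div_self (neg_ne_zero.2 this.ne'), one_div]

/-! ### The normalization -/

theorem tendsto_log_natCast {p : ℕ → ℕ} (hp : Tendsto p atTop atTop) :
    Tendsto (fun n => Real.log (p n)) atTop atTop :=
  Real.tendsto_log_atTop.comp (tendsto_natCast_atTop_atTop.comp hp)

theorem tendsto_sqrt_two_mul_atTop : Tendsto (fun L : ℝ => √(2 * L)) atTop atTop :=
  Real.tendsto_sqrt_atTop.comp (tendsto_id.const_mul_atTop two_pos)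

theorem tendsto_log_add_div_sqrt (c : ℝ) :
    Tendsto (fun L : ℝ => (Real.log L + c) / (2 * √(2 * L))) atTop (𝓝 0) := by
  have h1 : Tendsto (fun L : ℝ => Real.log L / L ^ (1 / 2 : ℝ)) atTop (𝓝 0) :=
    (isLittleO_log_rpow_atTop (by norm_num)).tendsto_div_nhds_zero
  have h2 : Tendsto (fun L : ℝ => c / √L) atTop (𝓝 0) :=
    Real.tendsto_sqrt_atTop.const_div_atTop c
  have h3 := (h1.add h2).const_mul (1 / (2 * √2))
  rw [add_zero, mul_zero] at h3
  refine h3.congr fun L => ?_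
  rw [Real.sqrt_mul zero_le_two, ← Real.sqrt_eq_rpow, ← add_div, div_mul_div_comm, one_mul,
    mul_assoc]

theorem tendsto_gumbelNorm {p : ℕ → ℕ} (hp : Tendsto p atTop atTop) :
    Tendsto (fun n => gumbelNorm (p n)) atTop atTop := by
  have hL := tendsto_log_natCast hp
  have h1 := tendsto_sqrt_two_mul_atTop.comp hL
  have h2 := (tendsto_log_add_div_sqrt (Real.log (4 * Real.pi))).comp hL
  simpa [gumbelNorm, sub_eq_add_neg] using h1.atTop_add h2.neg

theorem tendsto_gumbelNorm_add {p : ℕ → ℕ} (hp : Tendsto p atTop atTop) (x : ℝ) :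
    Tendsto (fun n => gumbelNorm (p n) + x / gumbelNorm (p n)) atTop atTop :=
  (tendsto_gumbelNorm hp).atTop_add ((tendsto_gumbelNorm hp).const_div_atTop x)

/-- Write `d = a - b` with `a = √(2 log p)` and `b → 0`, and `u = d + x/d`. The cross term `2ab` is
exactly `log log p + log 4π`, whence `p φ(u) = a exp (-x) exp (-(b² + (x/d)²)/2)`. The Mills ratio
divides by `u ∼ a`. -/
theorem tendsto_mul_normalTail {p : ℕ → ℕ} (hp : Tendsto p atTop atTop) (x : ℝ) :
    Tendsto (fun n => (p n : ℝ) * normalTail (gumbelNorm (p n) + x / gumbelNorm (p n)))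
      atTop (𝓝 (Real.exp (-x))) := by
  have hL := tendsto_log_natCast hp
  have hd := tendsto_gumbelNorm hp
  have hu := tendsto_gumbelNorm_add hp x
  have ha := tendsto_sqrt_two_mul_atTop.comp hL
  have hb := (tendsto_log_add_div_sqrt (Real.log (4 * Real.pi))).comp hL
  set L : ℕ → ℝ := fun n => Real.log (p n) with hLdef
  set d : ℕ → ℝ := fun n => gumbelNorm (p n) with hddef
  set u : ℕ → ℝ := fun n => d n + x / d n with hudef
  set a : ℕ → ℝ := (fun L : ℝ => √(2 * L)) ∘ L with hadef
  set b : ℕ → ℝ := (fun L : ℝ => (Real.log L + Real.log (4 * Real.pi)) / (2 * √(2 * L))) ∘ L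
    with hbdef
  have hdab : ∀ n, d n = a n - b n := fun n => rfl
  have hmills := tendsto_normalTail_div_atTop.comp hu
  have hxd : Tendsto (fun n => x / d n) atTop (𝓝 0) := hd.const_div_atTop x
  have hua : Tendsto (fun n => u n / a n) atTop (𝓝 1) := by
    have h1 : Tendsto (fun n => (-b n + x / d n) / a n) atTop (𝓝 0) :=
      (hb.neg.add hxd).div_atTop ha
    have h2 := h1.const_add 1
    rw [add_zero] at h2
    refine h2.congr' ?_
    filter_upwards [ha.eventually_gt_atTop 0] with n hn
    have h3 : u n = a n + (-b n + x / d n) := by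
      change d n + x / d n = _
      rw [hdab]
      ring
    rw [h3, add_div (a n), div_self hn.ne']
  have hau : Tendsto (fun n => a n / u n) atTop (𝓝 1) := by
    simpa using hua.inv₀ one_ne_zero
  have herr : Tendsto (fun n => Real.exp (-(b n ^ 2 + (x / d n) ^ 2) / 2)) atTop (𝓝 1) := by
    have h1 : Tendsto (fun n => -(b n ^ 2 + (x / d n) ^ 2) / 2) atTop (𝓝 0) := by
      simpa using (((hb.pow 2).add (hxd.pow 2)).neg.div_const 2)
    simpa [Function.comp_def] using (Real.continuous_exp.tendsto 0).comp h1
  have hprod : Tendsto (fun n => (normalTail (u n) / (gaussianPDFReal 0 1 (u n) * (u n)⁻¹)) *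
      ((a n / u n) * (Real.exp (-x) * Real.exp (-(b n ^ 2 + (x / d n) ^ 2) / 2))))
      atTop (𝓝 (Real.exp (-x))) := by
    simpa using hmills.mul (hau.mul (herr.const_mul (Real.exp (-x))))
  refine hprod.congr' ?_
  filter_upwards [ha.eventually_gt_atTop 0, hd.eventually_gt_atTop 0, hu.eventually_gt_atTop 0,
    hL.eventually_gt_atTop 0, hp.eventually_gt_atTop 0] with n hna hnd hnu hnL hnp
  have hpos : 0 < gaussianPDFReal 0 1 (u n) := gaussianPDFReal_pos 0 1 (u n) one_ne_zero
  have hpn : (0 : ℝ) < p n := by exact_mod_cast hnp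
  have ha2 : a n ^ 2 = 2 * L n := Real.sq_sqrt (by positivity)
  have hab : 2 * (a n * b n) = Real.log (L n) + Real.log (4 * Real.pi) := by
    have hbn : b n = (Real.log (L n) + Real.log (4 * Real.pi)) / (2 * a n) := rfl
    rw [hbn]
    field_simp
  have hu2 : u n ^ 2 = 2 * L n - (Real.log (L n) + Real.log (4 * Real.pi)) + 2 * x
      + (b n ^ 2 + (x / d n) ^ 2) := by
    have h1 : u n ^ 2 = d n ^ 2 + 2 * x + (x / d n) ^ 2 := by
      have : u n = d n + x / d n := rfl
      rw [this]
      field_simp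
      ring
    rw [h1, hdab, ← ha2, ← hab]
    ring
  have hkey : (p n : ℝ) * gaussianPDFReal 0 1 (u n)
      = a n * (Real.exp (-x) * Real.exp (-(b n ^ 2 + (x / d n) ^ 2) / 2)) := by
    have hp' : (p n : ℝ) = Real.exp (L n) := (Real.exp_log hpn).symm
    -- The constant `log 4π` is what makes this exact: `√(4π L) / √(2π) = √(2 L)`.
    have ha' : a n = (√(2 * Real.pi))⁻¹ * Real.exp ((Real.log (L n) + Real.log (4 * Real.pi)) / 2) := by
      rw [← Real.log_mul hnL.ne' (by positivity), ← Real.log_sqrt (by positivity),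
        Real.exp_log (by positivity), ← Real.sqrt_inv, ← Real.sqrt_mul (by positivity)]
      change √(2 * L n) = _
      congr 1
      field_simp
      ring
    rw [gaussianPDFReal_zero_one, hp', ha', hu2]
    rw [mul_left_comm, mul_assoc, ← Real.exp_add, ← Real.exp_add, ← Real.exp_add]
    congr 2
    ring
  have : (a n / u n) * (Real.exp (-x) * Real.exp (-(b n ^ 2 + (x / d n) ^ 2) / 2))
      = (p n : ℝ) * (gaussianPDFReal 0 1 (u n) * (u n)⁻¹) := by
    rw [← mul_assoc (p n : ℝ), hkey]
    ring
  rw [this]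
  have h0 : gaussianPDFReal 0 1 (u n) * (u n)⁻¹ ≠ 0 := (mul_pos hpos (inv_pos.2 hnu)).ne'
  rw [mul_comm (p n : ℝ), ← mul_assoc, div_mul_cancel₀ _ h0, mul_comm]

/-! ### The renewal equation of the unit rate Poisson process -/

theorem measurable_exponentialPDF_one : Measurable (exponentialPDF 1) :=
  (measurable_exponentialPDFReal 1).ennreal_ofReal

theorem exponentialPDF_one_smul {F : Type*} [NormedAddCommGroup F] [NormedSpace ℝ F] (f : ℝ → F) :
    (fun u => (exponentialPDF 1 u).toReal • f u)
      = (Set.Ici 0).indicator fun u => Real.exp (-u) • f u := by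
  funext u
  by_cases hu : 0 ≤ u
  · rw [Set.indicator_of_mem (by exact hu), exponentialPDF_of_nonneg hu,
      ENNReal.toReal_ofReal (by positivity)]
    simp
  · rw [Set.indicator_of_notMem (by simpa using hu), exponentialPDF_of_neg (not_le.1 hu)]
    simp

theorem integral_expMeasure_one {F : Type*} [NormedAddCommGroup F] [NormedSpace ℝ F] (f : ℝ → F) :
    ∫ u, f u ∂(expMeasure 1) = ∫ u in Set.Ioi 0, Real.exp (-u) • f u := by
  have h : expMeasure 1 = volume.withDensity (exponentialPDF 1) := rfl
  rw [h, integral_withDensity_eq_integral_toReal_smul measurable_exponentialPDF_one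
    (Eventually.of_forall fun _ => ENNReal.ofReal_lt_top), exponentialPDF_one_smul,
    integral_indicator measurableSet_Ici, integral_Ici_eq_integral_Ioi]

theorem integrable_id_expMeasure_one : Integrable id (expMeasure 1) := by
  have h : expMeasure 1 = volume.withDensity (exponentialPDF 1) := rfl
  rw [h, integrable_withDensity_iff_integrable_smul' measurable_exponentialPDF_one
    (Eventually.of_forall fun _ => ENNReal.ofReal_lt_top), exponentialPDF_one_smul,
    integrable_indicator_iff measurableSet_Ici, integrableOn_Ici_iff_integrableOn_Ioi]
  refine (Real.GammaIntegral_convergent two_pos).congr_fun (fun u _ => ?_) measurableSet_Ioi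
  norm_num

theorem integral_id_expMeasure_one : ∫ u, u ∂(expMeasure 1) = 1 := by
  rw [integral_expMeasure_one, ← Real.Gamma_two, Real.Gamma_eq_integral two_pos]
  refine setIntegral_congr_fun measurableSet_Ioi fun u _ => ?_
  norm_num

theorem ae_pos_expMeasure_one : ∀ᵐ u ∂(expMeasure 1), 0 < u := by
  have : IsProbabilityMeasure (expMeasure 1) := isProbabilityMeasure_expMeasure one_pos
  have h : (expMeasure 1).real (Set.Iic 0) = 0 := by
    rw [← cdf_eq_real, cdf_expMeasure_eq one_pos]
    simp
  rw [measureReal_eq_zero_iff] at h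
  rw [ae_iff]
  simpa [Set.Iic] using h

theorem lipschitzWith_intervalIntegral {F : Type*} [NormedAddCommGroup F] [NormedSpace ℝ F]
    {f : ℝ → F} (hf : ∀ a b, IntervalIntegrable f volume a b) {C : NNReal}
    (hC : ∀ t, ‖f t‖ ≤ C) (c : ℝ) : LipschitzWith C (fun x => ∫ t in c..x, f t) := by
  refine LipschitzWith.of_dist_le_mul fun x y => ?_
  rw [dist_eq_norm, intervalIntegral.integral_interval_sub_left (hf c x) (hf c y), dist_comm,
    Real.dist_eq, abs_sub_comm]
  exact intervalIntegral.norm_integral_le_of_norm_le_const fun t _ => hC t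

/-- The Laplace functional `exp (-∫ (1 - g))` of a unit rate Poisson process on `(s, ∞)`. -/
def expTail (g : ℝ → ℂ) (s : ℝ) : ℂ := Complex.exp (-∫ t in Set.Ioi s, (1 - g t))

/-- Since `‖g‖ ≤ 1`, the real part of `1 - g` is nonnegative. -/
theorem norm_expTail_le {g : ℝ → ℂ} (hb : ∀ t, ‖g t‖ ≤ 1)
    (hi : Integrable fun t => 1 - g t) (s : ℝ) : ‖expTail g s‖ ≤ 1 := by
  rw [expTail, Complex.norm_exp, Real.exp_le_one_iff, Complex.neg_re, neg_nonpos]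
  have h := integral_re (𝕜 := ℂ) (hi.integrableOn (s := Set.Ioi s))
  simp only [RCLike.re_to_complex] at h
  rw [← h]
  refine integral_nonneg fun t => ?_
  have := (Complex.re_le_norm (g t)).trans (hb t)
  simpa using this

theorem expTail_add {g : ℝ → ℂ} (hi : Integrable fun t => 1 - g t) (s : ℝ) {u : ℝ} (hu : 0 ≤ u) :
    expTail g (s + u) = Complex.exp (-(∫ t in Set.Ioi s, (1 - g t)) + ∫ t in 0..u, (1 - g (s + t))) := by
  rw [expTail, intervalIntegral.integral_comp_add_left (fun t => 1 - g t) s, add_zero,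
    ← intervalIntegral.integral_Ioi_sub_Ioi hi.integrableOn (by linarith)]
  congr 1
  ring

theorem continuous_expTail {g : ℝ → ℂ} (hi : Integrable fun t => 1 - g t) :
    Continuous (expTail g) := by
  have h : expTail g = fun s => Complex.exp (-((∫ t in Set.Ioi 0, (1 - g t))
      - ∫ t in (0 : ℝ)..s, (1 - g t))) := by
    funext s
    rw [expTail]
    congr 2
    rcases le_total 0 s with h | h
    · rw [← intervalIntegral.integral_Ioi_sub_Ioi hi.integrableOn h]; ring
    · rw [intervalIntegral.integral_symm,
        ← intervalIntegral.integral_Ioi_sub_Ioi hi.integrableOn h]; ring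
  rw [h]
  have : Continuous fun s => ∫ t in (0 : ℝ)..s, (1 - g t) :=
    intervalIntegral.continuous_primitive (fun a b => hi.intervalIntegrable) 0
  fun_prop

theorem tendsto_expTail_atTop {g : ℝ → ℂ} (hi : Integrable fun t => 1 - g t) :
    Tendsto (expTail g) atTop (𝓝 1) := by
  have h1 := intervalIntegral_tendsto_integral_Ioi 0 hi.integrableOn tendsto_id
  have h2 : Tendsto (fun s => ∫ t in Set.Ioi s, (1 - g t)) atTop (𝓝 0) := by
    have h3 := h1.const_sub (∫ t in Set.Ioi 0, (1 - g t))
    rw [sub_self] at h3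
    refine h3.congr' ?_
    filter_upwards [eventually_ge_atTop 0] with s hs
    rw [id, ← intervalIntegral.integral_Ioi_sub_Ioi hi.integrableOn hs]
    ring
  have h4 := (Complex.continuous_exp.tendsto (-0)).comp h2.neg
  rw [neg_zero, Complex.exp_zero] at h4
  exact h4

/-- The function `k(u) = exp (-u) * expTail g (s + u)` has derivative `-g(s + u) k(u)` and vanishes
at infinity, so the integral telescopes to `k 0`. As `g` is only measurable, the derivative exists
only almost everywhere, and the fundamental theorem is applied through absolute continuity. -/
theorem integral_mul_expTail {g : ℝ → ℂ} (hg : Measurable g) (hb : ∀ t, ‖g t‖ ≤ 1)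
    (hi : Integrable fun t => 1 - g t) (s : ℝ) :
    ∫ u, g (s + u) * expTail g (s + u) ∂(expMeasure 1) = expTail g s := by
  set f : ℝ → ℂ := fun t => 1 - g (s + t) with hf
  have hfi : Integrable f := hi.comp_add_left s
  have hfint : ∀ a b, IntervalIntegrable f volume a b := fun a b => hfi.intervalIntegrable
  have hfb : ∀ t, ‖f t‖ ≤ (2 : NNReal) := fun t => by
    refine (norm_sub_le _ _).trans ?_
    have := hb (s + t)
    simp only [norm_one, NNReal.coe_ofNat]
    linarith
  set c : ℂ := -∫ t in Set.Ioi s, (1 - g t) with hc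
  -- Writing the exponent with an interval integral makes it Lipschitz on the whole line.
  set q : ℝ → ℂ := fun u => -(u : ℂ) + (c + ∫ t in (0 : ℝ)..u, f t) with hq
  set k : ℝ → ℂ := fun u => Complex.exp (q u) with hk
  have hkeq : ∀ u, 0 ≤ u → k u = Real.exp (-u) * expTail g (s + u) := by
    intro u hu
    rw [expTail_add hi s hu, hk, hq]
    simp only
    rw [Complex.exp_add, Complex.ofReal_exp, Complex.ofReal_neg]
  have hknorm : ∀ u, 0 ≤ u → ‖k u‖ ≤ Real.exp (-u) := by
    intro u hu
    rw [hkeq u hu, norm_mul, Complex.norm_real, Real.norm_of_nonneg (Real.exp_pos _).le]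
    exact mul_le_of_le_one_right (Real.exp_pos _).le (norm_expTail_le hb hi _)
  have hqlip : LipschitzWith (1 + 2) q := by
    refine LipschitzWith.add ?_ ?_
    · exact (Complex.isometry_ofReal.lipschitz).neg
    · have h := lipschitzWith_intervalIntegral hfint hfb 0
      exact LipschitzWith.of_dist_le_mul fun x y => by
        simpa using h.dist_le_mul x y
  have hqcont : Continuous q := hqlip.continuous
  have hkcont : Continuous k := Complex.continuous_exp.comp hqcont
  set m : ℝ → ℂ := fun u => g (s + u) * k u with hm
  have hmmeas : Measurable m := (hg.comp (measurable_const_add s)).mul hkcont.measurable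
  have hmint : IntegrableOn m (Set.Ioi 0) := by
    refine Integrable.mono' (integrableOn_exp_neg_Ioi 0) hmmeas.aestronglyMeasurable ?_
    refine (ae_restrict_iff' measurableSet_Ioi).2 (Eventually.of_forall fun u hu => ?_)
    rw [hm, norm_mul]
    exact (mul_le_of_le_one_left (norm_nonneg _) (hb _)).trans (hknorm u (le_of_lt hu))
  have hmII : ∀ a b, IntervalIntegrable m volume a b := by
    intro a b
    refine (hkcont.intervalIntegrable a b).mono_fun hmmeas.aestronglyMeasurable ?_
    refine Eventually.of_forall fun u => ?_
    simp only [hm, norm_mul]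
    exact mul_le_of_le_one_left (norm_nonneg _) (hb _)
  -- Fundamental theorem of calculus for the Lipschitz function `k`.
  have hftc : ∀ R, 0 ≤ R → ∫ u in (0 : ℝ)..R, m u = k 0 - k R := by
    intro R hR
    obtain ⟨M, hM⟩ := (isCompact_uIcc (a := (0 : ℝ)) (b := R)).exists_bound_of_continuousOn
      hqcont.continuousOn
    -- The exponential is only locally Lipschitz, hence the restriction to a ball containing the
    -- image of `q` on `[0, R]`.
    obtain ⟨K, hK⟩ := ContDiffOn.exists_lipschitzOnWith (n := 1)
      (Complex.contDiff_exp.contDiffOn (s := Metric.closedBall (0 : ℂ) M)) one_ne_zero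
      (convex_closedBall 0 M) (isCompact_closedBall 0 M)
    have hkAC : AbsolutelyContinuousOnInterval k 0 R := by
      refine LipschitzOnWith.absolutelyContinuousOnInterval (K := K * (1 + 2)) ?_
      exact hK.comp hqlip.lipschitzOnWith fun u hu => by simpa using hM u hu
    obtain ⟨Mk, hMk⟩ := (isCompact_uIcc (a := (0 : ℝ)) (b := R)).exists_bound_of_continuousOn
      hkcont.continuousOn
    have hMk0 : 0 ≤ Mk := (norm_nonneg _).trans (hMk 0 Set.left_mem_uIcc)
    have hIAC : AbsolutelyContinuousOnInterval (fun x => ∫ t in (0 : ℝ)..x, m t) 0 R := by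
      refine LipschitzOnWith.absolutelyContinuousOnInterval (K := ⟨Mk, hMk0⟩) ?_
      refine LipschitzOnWith.of_dist_le_mul fun x hx y hy => ?_
      rw [dist_eq_norm, intervalIntegral.integral_interval_sub_left (hmII 0 x) (hmII 0 y),
        dist_comm, Real.dist_eq, abs_sub_comm]
      refine intervalIntegral.norm_integral_le_of_norm_le_const fun t ht => ?_
      refine (norm_mul_le _ _).trans
        ((mul_le_of_le_one_left (norm_nonneg _) (hb _)).trans (hMk t ?_))
      exact Set.uIcc_subset_uIcc hy hx (Set.uIoc_subset_uIcc ht)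
    -- By Lebesgue differentiation the derivative of `k + ∫ m` is zero almost everywhere, so this
    -- absolutely continuous function is constant.
    obtain ⟨C, hC⟩ := (hkAC.fun_add hIAC).const_of_ae_hasDerivAt_zero (by
      filter_upwards [(hfint 0 R).ae_hasDerivAt_integral, (hmII 0 R).ae_hasDerivAt_integral]
        with x hx1 hx2 hx
      have h1 := hx1 hx 0 Set.left_mem_uIcc
      have h2 := hx2 hx 0 Set.left_mem_uIcc
      have hid : HasDerivAt (fun u : ℝ => -(u : ℂ)) (-1) x := (Complex.ofRealCLM.hasDerivAt (x := x)).neg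
      have h3 : HasDerivAt q (-1 + f x) x := hid.add (h1.const_add c)
      have h4 : HasDerivAt (fun i => k i + ∫ t in (0 : ℝ)..i, m t) (k x * (-1 + f x) + m x) x :=
        h3.cexp.add h2
      have h5 : k x * (-1 + f x) + m x = 0 := by
        simp only [hm, hf]
        ring
      rwa [h5] at h4)
    have e1 := hC 0 Set.left_mem_uIcc
    have e2 := hC R Set.right_mem_uIcc
    simp only [intervalIntegral.integral_same, add_zero] at e1
    rw [e1, ← e2]
    ring
  have hlim1 := intervalIntegral_tendsto_integral_Ioi 0 hmint tendsto_id
  have hlim2 : Tendsto (fun R => k 0 - k R) atTop (𝓝 (k 0 - 0)) := by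
    refine Tendsto.const_sub _ (squeeze_zero_norm' ?_ Real.tendsto_exp_neg_atTop_nhds_zero)
    filter_upwards [eventually_ge_atTop 0] with R hR using hknorm R hR
  have hlim3 : Tendsto (fun R => ∫ u in (0 : ℝ)..(id R), m u) atTop (𝓝 (k 0 - 0)) := by
    refine hlim2.congr' ?_
    filter_upwards [eventually_ge_atTop 0] with R hR using (hftc R hR).symm
  have hfin := tendsto_nhds_unique hlim1 hlim3
  rw [integral_expMeasure_one]
  have hk0 : k 0 = expTail g s := by simp [hkeq 0 le_rfl]
  rw [sub_zero, hk0] at hfin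
  rw [← hfin]
  refine setIntegral_congr_fun measurableSet_Ioi fun u hu => ?_
  simp only [hm, hkeq u (le_of_lt hu), Complex.real_smul]
  ring

section Renewal

variable {Ω : Type*} [MeasurableSpace Ω] {P : Measure Ω} {E : ℕ → Ω → ℝ}

theorem aemeasurable_partialSum (hE : ∀ i, AEMeasurable (E i) P) (n : ℕ) :
    AEMeasurable (partialSum E n) P := by
  unfold partialSum
  exact Finset.aemeasurable_fun_sum _ fun i _ => hE i

theorem norm_prod_le_one {g : ℝ → ℂ} (hb : ∀ t, ‖g t‖ ≤ 1) {ι : Type*} (s : Finset ι) (x : ι → ℝ) :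
    ‖∏ i ∈ s, g (x i)‖ ≤ 1 := by
  rw [norm_prod]
  exact Finset.prod_le_one (fun _ _ => norm_nonneg _) fun _ _ => hb _

theorem aemeasurable_prod_partialSum (hE : ∀ i, AEMeasurable (E i) P) {g : ℝ → ℂ}
    (hg : Measurable g) (n : ℕ) :
    AEMeasurable (fun ω => ∏ i ∈ Finset.range n, g (partialSum E (i + 1) ω)) P :=
  Finset.aemeasurable_fun_prod _ fun _ _ => hg.comp_aemeasurable (aemeasurable_partialSum hE _)

theorem integral_comp_indepFun [IsProbabilityMeasure P] {α F : Type*} [MeasurableSpace α] [NormedAddCommGroup F]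
    [NormedSpace ℝ F] {Y : Ω → α} {Z : Ω → ℝ} (hY : AEMeasurable Y P) (hZ : AEMeasurable Z P)
    (h : IndepFun Y Z P) {Ψ : α × ℝ → F} (hΨ : StronglyMeasurable Ψ) {C : ℝ}
    (hC : ∀ z, ‖Ψ z‖ ≤ C) :
    ∫ ω, Ψ (Y ω, Z ω) ∂P = ∫ y, ∫ u, Ψ (y, u) ∂(P.map Z) ∂(P.map Y) := by
  have := Measure.isProbabilityMeasure_map hY
  have := Measure.isProbabilityMeasure_map hZ
  rw [← integral_prod _ (Integrable.of_bound hΨ.aestronglyMeasurable C (Eventually.of_forall hC)),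
    ← (indepFun_iff_map_prod_eq_prod_map_map hY hZ).1 h,
    integral_map (hY.prodMk hZ) hΨ.aestronglyMeasurable]

/-- Induction on `n`: integrating out the last spacing, which is independent of the earlier ones, is
one application of the renewal equation with `s` the current partial sum. -/
theorem integral_prod_mul_expTail [IsProbabilityMeasure P] (hindep : iIndepFun E P)
    (hlaw : ∀ i, HasLaw (E i) (expMeasure 1) P) {g : ℝ → ℂ} (hg : Measurable g)
    (hb : ∀ t, ‖g t‖ ≤ 1) (hi : Integrable fun t => 1 - g t) (n : ℕ) :
    ∫ ω, (∏ i ∈ Finset.range n, g (partialSum E (i + 1) ω)) * expTail g (partialSum E n ω) ∂P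
      = expTail g 0 := by
  have hE : ∀ i, AEMeasurable (E i) P := fun i => (hlaw i).aemeasurable
  induction n with
  | zero => simp [partialSum]
  | succ n ih =>
    let Y : Ω → (Finset.range n → ℝ) := fun ω i => E i ω
    -- The default `0` is never read: only indices below `n` enter the sums.
    let ext : (Finset.range n → ℝ) → ℕ → ℝ := fun y t => if h : t ∈ Finset.range n then y ⟨t, h⟩ else 0
    have hext : ∀ t, Measurable fun y => ext y t := by
      intro t
      by_cases h : t ∈ Finset.range n
      · simpa only [ext, h, dif_pos] using measurable_pi_apply _
      · simp only [ext, h, dif_neg, not_false_eq_true, measurable_const]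
    have hsum : ∀ k ≤ n, ∀ ω, partialSum E k ω = ∑ t ∈ Finset.range k, ext (Y ω) t := by
      intro k hk ω
      refine Finset.sum_congr rfl fun t ht => ?_
      have : t ∈ Finset.range n := Finset.mem_range.2 ((Finset.mem_range.1 ht).trans_le hk)
      simp only [ext, this, dif_pos, Y]
    let γ : (Finset.range n → ℝ) → ℝ := fun y => ∑ t ∈ Finset.range n, ext y t
    let a : (Finset.range n → ℝ) → ℂ := fun y =>
      ∏ i ∈ Finset.range n, g (∑ t ∈ Finset.range (i + 1), ext y t)
    have hγ : Measurable γ := Finset.measurable_fun_sum _ fun t _ => hext t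
    have ha : Measurable a := Finset.measurable_fun_prod _ fun i _ =>
      hg.comp (Finset.measurable_fun_sum _ fun t _ => hext t)
    have hγY : ∀ ω, partialSum E n ω = γ (Y ω) := fun ω => hsum n le_rfl ω
    have haY : ∀ ω, ∏ i ∈ Finset.range n, g (partialSum E (i + 1) ω) = a (Y ω) := fun ω =>
      Finset.prod_congr rfl fun i hin => by rw [hsum (i + 1) (Finset.mem_range.1 hin) ω]
    let Ψ : (Finset.range n → ℝ) × ℝ → ℂ := fun z =>
      a z.1 * (g (γ z.1 + z.2) * expTail g (γ z.1 + z.2))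
    have hΨ : Measurable Ψ := by
      have h1 : Measurable fun z : (Finset.range n → ℝ) × ℝ => γ z.1 + z.2 :=
        (hγ.comp measurable_fst).add measurable_snd
      exact (ha.comp measurable_fst).mul
        ((hg.comp h1).mul ((continuous_expTail hi).measurable.comp h1))
    have hΨb : ∀ z, ‖Ψ z‖ ≤ 1 := by
      intro z
      simp only [Ψ, norm_mul]
      exact mul_le_one₀ (norm_prod_le_one hb _ _) (by positivity)
        (mul_le_one₀ (hb _) (norm_nonneg _) (norm_expTail_le hb hi _))
    have hYm : AEMeasurable Y P := aemeasurable_pi_lambda _ fun i => hE i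
    have hind : IndepFun Y (E n) P := by
      have h := hindep.indepFun_finset₀ (Finset.range n) {n} (by simp) hE
      exact h.comp (φ := id) (ψ := fun v : ({n} : Finset ℕ) → ℝ => v ⟨n, by simp⟩) measurable_id
        (measurable_pi_apply _)
    have hstep : ∀ ω, (∏ i ∈ Finset.range (n + 1), g (partialSum E (i + 1) ω))
        * expTail g (partialSum E (n + 1) ω) = Ψ (Y ω, E n ω) := by
      intro ω
      have h1 : partialSum E (n + 1) ω = γ (Y ω) + E n ω := by
        rw [partialSum, Finset.sum_range_succ, ← hγY]
        rfl
      rw [Finset.prod_range_succ, haY, h1, mul_assoc]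
    simp_rw [hstep]
    rw [integral_comp_indepFun hYm (hE n) hind hΨ.stronglyMeasurable hΨb, (hlaw n).map_eq, ← ih]
    simp only [Ψ, integral_const_mul, integral_mul_expTail hg hb hi]
    have hm : Measurable fun y => a y * expTail g (γ y) :=
      ha.mul ((continuous_expTail hi).measurable.comp hγ)
    rw [integral_map hYm hm.aestronglyMeasurable]
    refine integral_congr_ae (Eventually.of_forall fun ω => ?_)
    simp only [haY, hγY]

theorem ae_tendsto_partialSum_atTop [IsProbabilityMeasure P] (hindep : iIndepFun E P)
    (hlaw : ∀ i, HasLaw (E i) (expMeasure 1) P) :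
    ∀ᵐ ω ∂P, Tendsto (fun n => partialSum E n ω) atTop atTop := by
  have hint : Integrable (E 0) P := by
    have h := integrable_id_expMeasure_one
    rw [← (hlaw 0).map_eq] at h
    exact h.comp_aemeasurable (hlaw 0).aemeasurable
  have hmean : ∫ ω, E 0 ω ∂P = 1 := by
    have h := integral_id_expMeasure_one
    rwa [← (hlaw 0).map_eq,
      integral_map (f := fun u : ℝ => u) (hlaw 0).aemeasurable
        measurable_id'.aestronglyMeasurable] at h
  have hid : ∀ i, IdentDistrib (E i) (E 0) P P := fun i =>
    ⟨(hlaw i).aemeasurable, (hlaw 0).aemeasurable, by rw [(hlaw i).map_eq, (hlaw 0).map_eq]⟩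
  filter_upwards [strong_law_ae_real E hint (fun i j hij => hindep.indepFun hij) hid] with ω hω
  rw [hmean] at hω
  have h := hω.pos_mul_atTop one_pos tendsto_natCast_atTop_atTop
  refine h.congr' ?_
  filter_upwards [eventually_gt_atTop 0] with n hn
  have : (n : ℝ) ≠ 0 := by positivity
  rw [div_mul_cancel₀ _ this]
  rfl

theorem ae_pos_partialSum (hlaw : ∀ i, HasLaw (E i) (expMeasure 1) P) :
    ∀ᵐ ω ∂P, ∀ n, 0 < partialSum E (n + 1) ω := by
  have h : ∀ᵐ ω ∂P, ∀ i, 0 < E i ω := by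
    refine ae_all_iff.2 fun i => ?_
    have := ae_pos_expMeasure_one
    rw [← (hlaw i).map_eq] at this
    exact ae_of_ae_map (hlaw i).aemeasurable this
  filter_upwards [h] with ω hω n
  exact Finset.sum_pos (fun i _ => hω i) (by simp)

/-- Almost surely `Γ_n → ∞`, so the factor `expTail g (Γ_n)` in the iterated identity tends to `1`
and can be dropped by dominated convergence. -/
theorem tendsto_integral_prod_partialSum [IsProbabilityMeasure P] (hindep : iIndepFun E P)
    (hlaw : ∀ i, HasLaw (E i) (expMeasure 1) P) {g : ℝ → ℂ} (hg : Measurable g)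
    (hb : ∀ t, ‖g t‖ ≤ 1) (hi : Integrable fun t => 1 - g t) :
    Tendsto (fun n => ∫ ω, ∏ i ∈ Finset.range n, g (partialSum E (i + 1) ω) ∂P) atTop
      (𝓝 (expTail g 0)) := by
  have hE : ∀ i, AEMeasurable (E i) P := fun i => (hlaw i).aemeasurable
  have hA : ∀ n, AEMeasurable (fun ω => ∏ i ∈ Finset.range n, g (partialSum E (i + 1) ω)) P :=
    aemeasurable_prod_partialSum hE hg
  have hT : ∀ n, AEMeasurable (fun ω => expTail g (partialSum E n ω)) P := fun n =>
    (continuous_expTail hi).measurable.comp_aemeasurable (aemeasurable_partialSum hE n)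
  have hdiff : Tendsto (fun n => ∫ ω, (∏ i ∈ Finset.range n, g (partialSum E (i + 1) ω)) *
      (1 - expTail g (partialSum E n ω)) ∂P) atTop (𝓝 (∫ _, (0 : ℂ) ∂P)) := by
    refine tendsto_integral_of_dominated_convergence (fun _ => 2)
      (fun n => ((hA n).mul ((hT n).const_sub 1)).aestronglyMeasurable) (integrable_const _)
      (fun n => Eventually.of_forall fun ω => ?_) ?_
    · rw [norm_mul]
      have h1 := norm_prod_le_one hb (Finset.range n) fun i => partialSum E (i + 1) ω
      have h2 := (norm_sub_le 1 (expTail g (partialSum E n ω))).trans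
        (add_le_add norm_one.le (norm_expTail_le hb hi _))
      nlinarith [norm_nonneg (1 - expTail g (partialSum E n ω))]
    · filter_upwards [ae_tendsto_partialSum_atTop hindep hlaw] with ω hω
      have h1 := (((tendsto_expTail_atTop hi).comp hω).const_sub 1).norm
      rw [sub_self, norm_zero] at h1
      refine squeeze_zero_norm (fun n => ?_) h1
      rw [norm_mul]
      exact mul_le_of_le_one_left (norm_nonneg _) (norm_prod_le_one hb _ _)
  rw [integral_zero] at hdiff
  have h := hdiff.add_const (expTail g 0)
  rw [zero_add] at h
  refine h.congr fun n => ?_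
  rw [← integral_prod_mul_expTail hindep hlaw hg hb hi n, ← integral_add]
  · refine integral_congr_ae (Eventually.of_forall fun ω => ?_)
    simp only
    ring
  · refine Integrable.of_bound ((hA n).mul ((hT n).const_sub 1)).aestronglyMeasurable 2
      (Eventually.of_forall fun ω => ?_)
    rw [norm_mul]
    have h1 := norm_prod_le_one hb (Finset.range n) fun i => partialSum E (i + 1) ω
    have h2 := (norm_sub_le 1 (expTail g (partialSum E n ω))).trans
      (add_le_add norm_one.le (norm_expTail_le hb hi _))
    nlinarith [norm_nonneg (1 - expTail g (partialSum E n ω))]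
  · refine Integrable.of_bound ((hA n).mul (hT n)).aestronglyMeasurable 1
      (Eventually.of_forall fun ω => ?_)
    rw [norm_mul]
    exact mul_le_one₀ (norm_prod_le_one hb _ _) (norm_nonneg _) (norm_expTail_le hb hi _)

end Renewal

/-! ### Point measures on `(-∞, ∞]` -/

theorem iUnion_Ioi_toUpperReal_neg : ⋃ k : ℕ, Set.Ioi (toUpperReal (-(k : ℝ))) = Set.univ := by
  refine Set.eq_univ_of_forall fun y => Set.mem_iUnion.2 ?_
  obtain ⟨c, hc⟩ := EReal.lt_iff_exists_real_btwn.1 y.2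
  obtain ⟨k, hk⟩ := exists_nat_gt (-c)
  refine ⟨k, ?_⟩
  change ((-(k : ℝ) : ℝ) : EReal) < y
  exact (EReal.coe_lt_coe_iff.2 (by linarith)).trans hc.2

theorem exists_subset_Ioi_of_isCompact {K : Set UpperReal} (hK : IsCompact K) :
    ∃ c : ℝ, K ⊆ Set.Ioi (toUpperReal c) := by
  have : Nonempty UpperReal := ⟨toUpperReal 0⟩
  obtain ⟨a, ha⟩ := hK.bddBelow
  obtain ⟨c, hc⟩ := EReal.lt_iff_exists_real_btwn.1 a.2
  exact ⟨c, fun y hy => lt_of_lt_of_le (show toUpperReal c < a from hc.2) (ha hy)⟩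

theorem sum_dirac_apply {ι E : Type*} [MeasurableSpace E] (y : ι → E) {B : Set E}
    (hB : MeasurableSet B) :
    Measure.sum (fun i => Measure.dirac (y i)) B = ∑' i, B.indicator (1 : E → ENNReal) (y i) := by
  rw [Measure.sum_apply _ hB]
  simp_rw [Measure.dirac_apply' _ hB]

theorem sum_dirac_apply_eq_encard {ι E : Type*} [MeasurableSpace E] (y : ι → E) {B : Set E}
    (hB : MeasurableSet B) :
    Measure.sum (fun i => Measure.dirac (y i)) B = ({i | y i ∈ B}.encard : ENNReal) := by
  rw [sum_dirac_apply y hB, ← ENNReal.tsum_set_one, tsum_subtype {i | y i ∈ B} fun _ => (1 : ENNReal)]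
  rfl

/-- Compact subsets of `(-∞, ∞]` are bounded below by a real number, and only finitely many points
exceed it. -/
theorem isPointMeasure_sum_dirac_of_tendsto {x : ℕ → ℝ} (hx : Tendsto x atTop atBot) :
    IsPointMeasure (Measure.sum fun i => Measure.dirac (toUpperReal (x i))) := by
  refine ⟨fun K hK => ?_, fun B hB => ⟨_, sum_dirac_apply_eq_encard _ hB⟩⟩
  obtain ⟨c, hc⟩ := exists_subset_Ioi_of_isCompact hK
  refine (measure_mono hc).trans_lt ?_
  rw [sum_dirac_apply_eq_encard _ measurableSet_Ioi]
  have hfin : {i | toUpperReal (x i) ∈ Set.Ioi (toUpperReal c)}.Finite := by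
    obtain ⟨n, hn⟩ := eventually_atTop.1 (hx.eventually_le_atBot c)
    refine (Set.finite_lt_nat n).subset fun i hi => ?_
    by_contra h
    exact absurd (EReal.coe_lt_coe_iff.1 hi) (not_lt.2 (hn i (not_lt.1 h)))
  rw [← hfin.cast_ncard_eq]
  simp

/-- The number of points among `y 0, …, y (n - 1)` in the set `B`. -/
def countBefore {E : Type*} (B : Set E) (y : ℕ → E) (n : ℕ) : ℝ :=
  ∑ i ∈ Finset.range n, B.indicator (1 : E → ℝ) (y i)

theorem countBefore_eq_toReal {E : Type*} (B : Set E) (y : ℕ → E) (n : ℕ) :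
    countBefore B y n = (∑ i ∈ Finset.range n, B.indicator (1 : E → ENNReal) (y i)).toReal := by
  rw [countBefore, ENNReal.toReal_sum]
  · refine Finset.sum_congr rfl fun i _ => ?_
    by_cases h : y i ∈ B <;> simp [h]
  · intro i _
    by_cases h : y i ∈ B <;> simp [h]

theorem tendsto_countBefore {E : Type*} [MeasurableSpace E] {B : Set E} (hB : MeasurableSet B)
    (y : ℕ → E) (h : Measure.sum (fun i => Measure.dirac (y i)) B ≠ ⊤) :
    Tendsto (countBefore B y) atTop
      (𝓝 (Measure.sum (fun i => Measure.dirac (y i)) B).toReal) := by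
  have h1 := (ENNReal.tendsto_toReal h).comp (by
    simpa only [sum_dirac_apply y hB] using
      ENNReal.tendsto_nat_tsum fun i => B.indicator (1 : E → ENNReal) (y i))
  exact h1.congr fun n => (countBefore_eq_toReal B y n).symm

theorem tendsto_countBefore_atTop {E : Type*} [MeasurableSpace E] {B : Set E}
    (hB : MeasurableSet B) (y : ℕ → E) (h : Measure.sum (fun i => Measure.dirac (y i)) B = ⊤) :
    Tendsto (countBefore B y) atTop atTop := by
  have h1 := ENNReal.tendsto_nat_tsum fun i => B.indicator (1 : E → ENNReal) (y i)
  rw [← sum_dirac_apply y hB, h] at h1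
  refine tendsto_atTop.2 fun b => ?_
  filter_upwards [h1.eventually_const_lt (ENNReal.ofReal_lt_top (r := b))] with n hn
  rw [countBefore_eq_toReal]
  refine (ENNReal.ofReal_le_iff_le_toReal ?_).1 hn.le
  refine (ENNReal.sum_lt_top.2 fun i _ => ?_).ne
  by_cases h : y i ∈ B <;> simp [h]

/-! ### The intensity measure -/

/-- The map that takes the points `Γ_i` to the points `-log Γ_i`. -/
def negLog (t : ℝ) : UpperReal := toUpperReal (-Real.log t)

theorem measurable_negLog : Measurable negLog :=
  measurable_toUpperReal.comp Real.measurable_log.neg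

/-- Change of variables `t = exp (-x)`. -/
theorem expIntensity_eq_map : expIntensity = (volume.restrict (Set.Ioi 0)).map negLog := by
  refine Measure.ext fun B hB => ?_
  have hBm := measurable_toUpperReal hB
  rw [expIntensity, Measure.map_apply measurable_toUpperReal hB, withDensity_apply _ hBm,
    Measure.map_apply measurable_negLog hB, Measure.restrict_apply (measurable_negLog hB)]
  have himg : (fun x => Real.exp (-x)) '' (toUpperReal ⁻¹' B) = negLog ⁻¹' B ∩ Set.Ioi 0 := by
    ext t
    constructor
    · rintro ⟨x, hx, rfl⟩
      refine ⟨?_, Real.exp_pos _⟩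
      simpa [negLog] using hx
    · rintro ⟨h1, h2⟩
      exact ⟨-Real.log t, h1, by simp [Real.exp_log h2]⟩
  have h := lintegral_image_eq_lintegral_abs_deriv_mul (f := fun x => Real.exp (-x))
    (f' := fun x => -Real.exp (-x)) hBm
    (fun x _ => by simpa using ((hasDerivAt_neg x).exp).hasDerivWithinAt)
    (fun x _ z _ hxz => by simpa using hxz) (fun _ => 1)
  rw [himg] at h
  simp only [lintegral_one, Measure.restrict_apply MeasurableSet.univ, Set.univ_inter, mul_one,
    abs_neg, abs_of_pos (Real.exp_pos _)] at h
  exact h.symm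

/-! ### The limit process -/

section Limit

variable {Ω : Type*} [MeasurableSpace Ω] {P : Measure Ω} [IsProbabilityMeasure P] {E : ℕ → Ω → ℝ}

theorem ae_limitPointProcess_eq (hindep : iIndepFun E P)
    (hlaw : ∀ i, HasLaw (E i) (expMeasure 1) P) :
    ∀ᵐ ω ∂P, (limitPointProcess E ω).toMeasure
      = Measure.sum fun i => Measure.dirac (negLog (partialSum E (i + 1) ω)) := by
  filter_upwards [ae_tendsto_partialSum_atTop hindep hlaw] with ω hω
  have h : Tendsto (fun i => -Real.log (partialSum E (i + 1) ω)) atTop atBot :=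
    tendsto_neg_atTop_atBot.comp
      (Real.tendsto_log_atTop.comp (hω.comp (tendsto_add_atTop_nat 1)))
  rw [limitPointProcess, sumDirac, dif_pos (isPointMeasure_sum_dirac_of_tendsto h)]
  rfl

theorem aemeasurable_limitPointProcess_apply (hindep : iIndepFun E P)
    (hlaw : ∀ i, HasLaw (E i) (expMeasure 1) P) {B : Set UpperReal} (hB : MeasurableSet B) :
    AEMeasurable (fun ω => (limitPointProcess E ω).toMeasure B) P := by
  have h : AEMeasurable (fun ω => ∑' i : ℕ,
      B.indicator (1 : UpperReal → ENNReal) (negLog (partialSum E (i + 1) ω))) P := by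
    refine AEMeasurable.tsum fun i => ?_
    exact ((measurable_one.indicator hB).comp measurable_negLog).comp_aemeasurable
      (aemeasurable_partialSum (fun i => (hlaw i).aemeasurable) _)
  refine h.congr ?_
  filter_upwards [ae_limitPointProcess_eq hindep hlaw] with ω hω
  rw [hω, sum_dirac_apply _ hB]

theorem tendsto_integral_prod_negLog (hindep : iIndepFun E P)
    (hlaw : ∀ i, HasLaw (E i) (expMeasure 1) P) {G : UpperReal → ℂ} (hG : Measurable G)
    (hb : ∀ y, ‖G y‖ ≤ 1) (hi : Integrable (fun y => 1 - G y) expIntensity) :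
    Tendsto (fun n => ∫ ω, ∏ i ∈ Finset.range n, G (negLog (partialSum E (i + 1) ω)) ∂P) atTop
      (𝓝 (Complex.exp (-∫ y, (1 - G y) ∂expIntensity))) := by
  classical
  -- The value `1` off `(0, ∞)` makes `1 - g` integrable on the whole line; the almost surely
  -- positive `Γ_i` do not see it.
  let g : ℝ → ℂ := fun t => if 0 < t then G (negLog t) else 1
  have hgm : Measurable g :=
    Measurable.ite measurableSet_Ioi (hG.comp measurable_negLog) measurable_const
  have hgb : ∀ t, ‖g t‖ ≤ 1 := by
    intro t
    by_cases h : 0 < t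
    · simpa [g, h] using hb _
    · simp [g, h]
  have hsub : (fun t => 1 - g t) = (Set.Ioi 0).indicator fun t => 1 - G (negLog t) := by
    funext t
    by_cases h : 0 < t <;> simp [g, h]
  have h1Gm : Measurable fun y => 1 - G y := hG.const_sub 1
  have hgi : Integrable fun t => 1 - g t := by
    rw [hsub, integrable_indicator_iff measurableSet_Ioi]
    rw [expIntensity_eq_map] at hi
    exact hi.comp_measurable measurable_negLog
  have hint : ∫ t in Set.Ioi 0, (1 - g t) = ∫ y, (1 - G y) ∂expIntensity := by
    rw [expIntensity_eq_map,
      integral_map measurable_negLog.aemeasurable h1Gm.aestronglyMeasurable]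
    exact setIntegral_congr_fun measurableSet_Ioi fun t ht => by
      simp only [g, if_pos (show 0 < t from ht)]
  have h := tendsto_integral_prod_partialSum hindep hlaw hgm hgb hgi
  rw [expTail, hint] at h
  refine h.congr fun n => integral_congr_ae ?_
  filter_upwards [ae_pos_partialSum hlaw] with ω hω
  exact Finset.prod_congr rfl fun i _ => if_pos (hω i)

theorem integrable_one_sub_of_forall_notMem {α : Type*} [MeasurableSpace α] {m : Measure α}
    {G : α → ℂ} (hG : Measurable G) (hb : ∀ y, ‖G y‖ ≤ 1) {A : Set α}
    (hA : MeasurableSet A) (hm : m A ≠ ⊤) (hGA : ∀ y, y ∉ A → G y = 1) :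
    Integrable (fun y => 1 - G y) m := by
  have h : (fun y => 1 - G y) = A.indicator fun y => 1 - G y := by
    funext y
    by_cases hy : y ∈ A <;> simp [hy, hGA]
  rw [h, integrable_indicator_iff hA]
  refine Measure.integrableOn_of_bounded (M := 2) hm (hG.const_sub 1).aestronglyMeasurable
    (Eventually.of_forall fun y => ?_)
  refine (norm_sub_le _ _).trans ?_
  rw [norm_one]
  linarith [hb y]

/-- `exp (-c k)` for an extended number `k` of points, with the value `0` at `k = ∞`. -/
def expNegCount (c : ℝ) (k : ENNReal) : ℝ := if k = ⊤ then 0 else Real.exp (-(c * k.toReal))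

theorem measurable_expNegCount (c : ℝ) : Measurable (expNegCount c) := by
  refine Measurable.ite (measurableSet_singleton _) measurable_const ?_
  exact (Real.measurable_exp.comp ((ENNReal.measurable_toReal.const_mul c).neg))

theorem expNegCount_nonneg (c : ℝ) (k : ENNReal) : 0 ≤ expNegCount c k := by
  unfold expNegCount
  split_ifs <;> positivity

theorem expNegCount_le_one {c : ℝ} (hc : 0 ≤ c) (k : ENNReal) : expNegCount c k ≤ 1 := by
  unfold expNegCount
  split_ifs
  · exact zero_le_one
  · rw [Real.exp_le_one_iff, neg_nonpos]
    positivity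

theorem expNegCount_anti {c : ℝ} (hc : 0 ≤ c) {k l : ENNReal} (h : k ≤ l) :
    expNegCount c l ≤ expNegCount c k := by
  by_cases hl : l = ⊤
  · rw [expNegCount, if_pos hl]
    exact expNegCount_nonneg c k
  · have hk : k ≠ ⊤ := (h.trans_lt (lt_top_iff_ne_top.2 hl)).ne
    rw [expNegCount, expNegCount, if_neg hl, if_neg hk, Real.exp_le_exp, neg_le_neg_iff]
    exact mul_le_mul_of_nonneg_left (ENNReal.toReal_mono hl h) hc

theorem tendsto_exp_neg_countBefore {c : ℝ} (hc : 0 < c) {α : Type*} [MeasurableSpace α]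
    {B : Set α} (hB : MeasurableSet B) (y : ℕ → α) :
    Tendsto (fun n => Real.exp (-(c * countBefore B y n))) atTop
      (𝓝 (expNegCount c (Measure.sum (fun i => Measure.dirac (y i)) B))) := by
  unfold expNegCount
  split_ifs with h
  · exact Real.tendsto_exp_neg_atTop_nhds_zero.comp
      ((tendsto_countBefore_atTop hB y h).const_mul_atTop hc)
  · exact (Real.continuous_exp.tendsto _).comp ((tendsto_countBefore hB y h).const_mul c).neg

/-- The product functional with `G = exp (-c 1_B)`, for which `1 - G = (1 - exp (-c)) 1_B`. Real
exponents still give a limit when the count is infinite, so finiteness need not be known beforehand.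
-/
theorem integral_expNegCount (hindep : iIndepFun E P)
    (hlaw : ∀ i, HasLaw (E i) (expMeasure 1) P) {c : ℝ} (hc : 0 < c) {B : Set UpperReal}
    (hB : MeasurableSet B) (hm : expIntensity B ≠ ⊤) :
    ∫ ω, expNegCount c ((limitPointProcess E ω).toMeasure B) ∂P
      = Real.exp (-((1 - Real.exp (-c)) * expIntensity.real B)) := by
  classical
  let G : UpperReal → ℝ := fun y => Real.exp (-(c * B.indicator (1 : UpperReal → ℝ) y))
  have hGm : Measurable G :=
    Real.measurable_exp.comp ((measurable_one.indicator hB).const_mul c).neg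
  have hGm' : Measurable fun y => (G y : ℂ) := Complex.measurable_ofReal.comp hGm
  have hGb : ∀ y, ‖(G y : ℂ)‖ ≤ 1 := by
    intro y
    rw [Complex.norm_real, Real.norm_of_nonneg (Real.exp_pos _).le, Real.exp_le_one_iff,
      neg_nonpos]
    exact mul_nonneg hc.le (Set.indicator_nonneg (fun _ _ => zero_le_one) _)
  have hGB : ∀ y, y ∉ B → (G y : ℂ) = 1 := fun y hy => by simp [G, hy]
  have hi := integrable_one_sub_of_forall_notMem hGm' hGb hB hm hGB
  have hint : ∫ y, (1 - (G y : ℂ)) ∂expIntensity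
      = (((1 - Real.exp (-c)) * expIntensity.real B : ℝ) : ℂ) := by
    have h : (fun y => 1 - (G y : ℂ)) = B.indicator fun _ => ((1 - Real.exp (-c) : ℝ) : ℂ) := by
      funext y
      by_cases hy : y ∈ B <;> simp [G, hy]
    rw [h, integral_indicator_const _ hB, Complex.real_smul, mul_comm]
    push_cast
    ring
  have hprod : ∀ n ω, ∏ i ∈ Finset.range n, (G (negLog (partialSum E (i + 1) ω)) : ℂ)
      = ((Real.exp (-(c * countBefore B (fun i => negLog (partialSum E (i + 1) ω)) n)) : ℝ) : ℂ) := by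
    intro n ω
    rw [← Complex.ofReal_prod, ← Real.exp_sum, countBefore, Finset.mul_sum, Finset.sum_neg_distrib]
  have h1 := tendsto_integral_prod_negLog hindep hlaw hGm' hGb hi
  simp_rw [hprod, hint] at h1
  have h2 : Tendsto (fun n => ∫ ω, ((Real.exp (-(c * countBefore B
      (fun i => negLog (partialSum E (i + 1) ω)) n)) : ℝ) : ℂ) ∂P) atTop
      (𝓝 (∫ ω, ((expNegCount c ((limitPointProcess E ω).toMeasure B) : ℝ) : ℂ) ∂P)) := by
    refine tendsto_integral_of_dominated_convergence (fun _ => 1) (fun n => ?_)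
      (integrable_const _) (fun n => Eventually.of_forall fun ω => ?_) ?_
    · simp_rw [← hprod]
      exact (Finset.aemeasurable_fun_prod _ fun i _ =>
        (hGm'.comp measurable_negLog).comp_aemeasurable
          (aemeasurable_partialSum (fun i => (hlaw i).aemeasurable) _)).aestronglyMeasurable
    · rw [← hprod, norm_prod]
      exact Finset.prod_le_one (fun _ _ => norm_nonneg _) fun _ _ => hGb _
    · filter_upwards [ae_limitPointProcess_eq hindep hlaw] with ω hω
      rw [hω]
      exact (Complex.continuous_ofReal.tendsto _).comp (tendsto_exp_neg_countBefore hc hB _)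
  have h3 := tendsto_nhds_unique h2 h1
  rw [integral_complex_ofReal, ← Complex.ofReal_neg, ← Complex.ofReal_exp] at h3
  exact_mod_cast h3

theorem integrable_expNegCount (hindep : iIndepFun E P)
    (hlaw : ∀ i, HasLaw (E i) (expMeasure 1) P) {c : ℝ} (hc : 0 ≤ c) {B : Set UpperReal}
    (hB : MeasurableSet B) :
    Integrable (fun ω => expNegCount c ((limitPointProcess E ω).toMeasure B)) P := by
  refine Integrable.of_bound ((measurable_expNegCount c).comp_aemeasurable
    (aemeasurable_limitPointProcess_apply hindep hlaw hB)).aestronglyMeasurable 1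
    (Eventually.of_forall fun ω => ?_)
  rw [Real.norm_of_nonneg (expNegCount_nonneg _ _)]
  exact expNegCount_le_one hc _

/-- On the event of an infinite count `1 - expNegCount c` equals `1`, so Markov's inequality bounds
its probability by a quantity that vanishes as `c ↓ 0`. -/
theorem ae_limitPointProcess_ne_top (hindep : iIndepFun E P)
    (hlaw : ∀ i, HasLaw (E i) (expMeasure 1) P) {B : Set UpperReal} (hB : MeasurableSet B)
    (hm : expIntensity B ≠ ⊤) : ∀ᵐ ω ∂P, (limitPointProcess E ω).toMeasure B ≠ ⊤ := by
  have hle : ∀ c : ℝ, 0 < c → P.real {ω | (limitPointProcess E ω).toMeasure B = ⊤}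
      ≤ 1 - Real.exp (-((1 - Real.exp (-c)) * expIntensity.real B)) := by
    intro c hc
    have hi := integrable_expNegCount hindep hlaw hc.le hB
    have h1 : ∫ ω, (1 - expNegCount c ((limitPointProcess E ω).toMeasure B)) ∂P
        = 1 - ∫ ω, expNegCount c ((limitPointProcess E ω).toMeasure B) ∂P := by
      rw [integral_sub (integrable_const _) hi]
      simp
    rw [← integral_expNegCount hindep hlaw hc hB hm, ← h1]
    have h2 := mul_meas_ge_le_integral_of_nonneg (Eventually.of_forall fun ω =>
      sub_nonneg.2 (expNegCount_le_one hc.le ((limitPointProcess E ω).toMeasure B)))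
      ((integrable_const _).sub hi) 1
    rw [one_mul] at h2
    refine (measureReal_mono fun ω hω => ?_).trans h2
    have hω' : (limitPointProcess E ω).toMeasure B = ⊤ := hω
    simp [hω', expNegCount]
  have hlim : Tendsto (fun c : ℝ => 1 - Real.exp (-((1 - Real.exp (-c)) * expIntensity.real B)))
      (𝓝[>] 0) (𝓝 0) := by
    have : Continuous fun c : ℝ =>
      1 - Real.exp (-((1 - Real.exp (-c)) * expIntensity.real B)) := by fun_prop
    simpa using (this.tendsto 0).mono_left nhdsWithin_le_nhds
  have h0 : P.real {ω | (limitPointProcess E ω).toMeasure B = ⊤} ≤ 0 :=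
    ge_of_tendsto hlim (by filter_upwards [self_mem_nhdsWithin] with c hc using hle c hc)
  have h1 := le_antisymm h0 measureReal_nonneg
  rw [measureReal_eq_zero_iff] at h1
  rw [ae_iff]
  simpa using h1

/-- Exhaust `B` by the sets `B ∩ (-k, ∞]` of finite intensity. Their Laplace transforms at `c = 1`
dominate that of `B` and tend to zero, and `expNegCount 1` vanishes only at an infinite count. -/
theorem ae_limitPointProcess_eq_top (hindep : iIndepFun E P)
    (hlaw : ∀ i, HasLaw (E i) (expMeasure 1) P) {B : Set UpperReal} (hB : MeasurableSet B)
    (hm : expIntensity B = ⊤) : ∀ᵐ ω ∂P, (limitPointProcess E ω).toMeasure B = ⊤ := by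
  let A : ℕ → Set UpperReal := fun k => B ∩ Set.Ioi (toUpperReal (-(k : ℝ)))
  have hA : ∀ k, MeasurableSet (A k) := fun k => hB.inter measurableSet_Ioi
  have hAm : ∀ k, expIntensity (A k) ≠ ⊤ := fun k =>
    ((measure_mono Set.inter_subset_right).trans_lt
      (by rw [expIntensity_Ioi]; exact ENNReal.ofReal_lt_top)).ne
  have hmono : Monotone A := fun k l hkl => Set.inter_subset_inter_right _
    (Set.Ioi_subset_Ioi (EReal.coe_le_coe_iff.2 (by simpa using hkl)))
  have hU : ⋃ k, A k = B := by
    rw [← Set.inter_iUnion, iUnion_Ioi_toUpperReal_neg, Set.inter_univ]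
  have hmeas : Tendsto (fun k => expIntensity.real (A k)) atTop atTop := by
    have h := tendsto_measure_iUnion_atTop (μ := expIntensity) hmono
    rw [hU, hm] at h
    refine tendsto_atTop.2 fun b => ?_
    filter_upwards [h.eventually_const_lt (ENNReal.ofReal_lt_top (r := b))] with k hk
    exact (ENNReal.ofReal_le_iff_le_toReal (hAm k)).1 hk.le
  have hi := integrable_expNegCount hindep hlaw zero_le_one hB
  have hc : 0 < 1 - Real.exp (-1) := by simp
  have hle : ∀ k, ∫ ω, expNegCount 1 ((limitPointProcess E ω).toMeasure B) ∂P
      ≤ Real.exp (-((1 - Real.exp (-1)) * expIntensity.real (A k))) := by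
    intro k
    rw [← integral_expNegCount hindep hlaw one_pos (hA k) (hAm k)]
    exact integral_mono hi (integrable_expNegCount hindep hlaw zero_le_one (hA k))
      fun ω => expNegCount_anti zero_le_one (measure_mono Set.inter_subset_left)
  have h0 : ∫ ω, expNegCount 1 ((limitPointProcess E ω).toMeasure B) ∂P ≤ 0 :=
    ge_of_tendsto' (Real.tendsto_exp_neg_atTop_nhds_zero.comp (hmeas.const_mul_atTop hc)) hle
  have h1 := le_antisymm h0 (integral_nonneg fun ω => expNegCount_nonneg _ _)
  rw [integral_eq_zero_iff_of_nonneg (fun ω => expNegCount_nonneg _ _) hi] at h1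
  filter_upwards [h1] with ω hω
  by_contra h
  simp [expNegCount, h] at hω

end Limit

/-! ### Characters of vectors of counts -/

/-- The character `y ↦ exp (i ∑ⱼ tⱼ 1_{Bⱼ}(y))`. -/
def indicatorChar {ι E : Type*} [Fintype ι] (t : ι → ℝ) (B : ι → Set E) (y : E) : ℂ :=
  Complex.exp ((∑ j, t j * (B j).indicator (1 : E → ℝ) y : ℝ) * Complex.I)

theorem norm_indicatorChar {ι E : Type*} [Fintype ι] (t : ι → ℝ) (B : ι → Set E) (y : E) :
    ‖indicatorChar t B y‖ = 1 := Complex.norm_exp_ofReal_mul_I _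

theorem measurable_indicatorChar {ι E : Type*} [Fintype ι] [MeasurableSpace E] (t : ι → ℝ)
    {B : ι → Set E} (hB : ∀ j, MeasurableSet (B j)) : Measurable (indicatorChar t B) := by
  have h : Measurable fun y => ∑ j, t j * (B j).indicator (1 : E → ℝ) y :=
    Finset.measurable_fun_sum _ fun j _ => (measurable_one.indicator (hB j)).const_mul _
  exact Complex.measurable_exp.comp ((Complex.measurable_ofReal.comp h).mul_const _)

theorem indicatorChar_of_forall_notMem {ι E : Type*} [Fintype ι] (t : ι → ℝ) {B : ι → Set E}
    {y : E} (h : ∀ j, y ∉ B j) : indicatorChar t B y = 1 := by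
  simp [indicatorChar, h]

theorem prod_indicatorChar {ι E κ : Type*} [Fintype ι] (t : ι → ℝ) (B : ι → Set E)
    (s : Finset κ) (y : κ → E) :
    ∏ i ∈ s, indicatorChar t B (y i) = Complex.exp
      ((∑ j, t j * ∑ i ∈ s, (B j).indicator (1 : E → ℝ) (y i) : ℝ) * Complex.I) := by
  simp only [indicatorChar]
  rw [← Complex.exp_sum, ← Finset.sum_mul, ← Complex.ofReal_sum, Finset.sum_comm]
  simp_rw [Finset.mul_sum]

theorem integrable_one_sub_indicatorChar {ι E : Type*} [Fintype ι] [MeasurableSpace E]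
    {m : Measure E} (t : ι → ℝ) {B : ι → Set E} (hB : ∀ j, MeasurableSet (B j))
    (hm : ∀ j, m (B j) ≠ ⊤) : Integrable (fun y => 1 - indicatorChar t B y) m := by
  refine integrable_one_sub_of_forall_notMem (measurable_indicatorChar t hB)
    (fun y => (norm_indicatorChar t B y).le) (A := ⋃ j, B j) (MeasurableSet.iUnion hB) ?_ ?_
  · refine ((measure_iUnion_le B).trans_lt ?_).ne
    rw [tsum_fintype]
    exact ENNReal.sum_lt_top.2 fun j _ => lt_top_iff_ne_top.2 (hm j)
  · intro y hy
    exact indicatorChar_of_forall_notMem t fun j hj => hy (Set.mem_iUnion.2 ⟨j, hj⟩)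

theorem one_sub_indicatorChar_of_disjoint {ι E : Type*} [Fintype ι] (t : ι → ℝ) {B : ι → Set E}
    (hd : Pairwise fun i j => Disjoint (B i) (B j)) (y : E) :
    1 - indicatorChar t B y
      = ∑ j, (B j).indicator (fun _ => 1 - Complex.exp (t j * Complex.I)) y := by
  by_cases h : ∃ j, y ∈ B j
  · obtain ⟨j, hj⟩ := h
    have hne : ∀ i, i ≠ j → y ∉ B i := fun i hij hi => Set.disjoint_left.1 (hd hij) hi hj
    rw [Finset.sum_eq_single j (fun i _ hij => Set.indicator_of_notMem (hne i hij) _) (by simp),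
      Set.indicator_of_mem hj, indicatorChar,
      Finset.sum_eq_single j (fun i _ hij => by simp [hne i hij]) (by simp)]
    simp [hj]
  · push Not at h
    rw [indicatorChar_of_forall_notMem t h]
    simp [h]

theorem integral_one_sub_indicatorChar {ι E : Type*} [Fintype ι] [MeasurableSpace E]
    {m : Measure E} (t : ι → ℝ) {B : ι → Set E} (hB : ∀ j, MeasurableSet (B j))
    (hm : ∀ j, m (B j) ≠ ⊤) (hd : Pairwise fun i j => Disjoint (B i) (B j)) :
    ∫ y, (1 - indicatorChar t B y) ∂m
      = ∑ j, (m.real (B j) : ℂ) * (1 - Complex.exp (t j * Complex.I)) := by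
  simp_rw [one_sub_indicatorChar_of_disjoint t hd]
  rw [integral_finsetSum]
  · refine Finset.sum_congr rfl fun j _ => ?_
    rw [integral_indicator_const _ (hB j), Complex.real_smul]
  · exact fun j _ => (integrable_indicator_iff (hB j)).2 (integrableOn_const (hm j))

/-! ### Poisson laws and independence of the counts -/

section Limit

variable {Ω : Type*} [MeasurableSpace Ω] {P : Measure Ω} [IsProbabilityMeasure P] {E : ℕ → Ω → ℝ}

theorem aemeasurable_limitPointProcess_real (hindep : iIndepFun E P)
    (hlaw : ∀ i, HasLaw (E i) (expMeasure 1) P) {B : Set UpperReal} (hB : MeasurableSet B) :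
    AEMeasurable (fun ω => (limitPointProcess E ω).toMeasure.real B) P :=
  ENNReal.measurable_toReal.comp_aemeasurable (aemeasurable_limitPointProcess_apply hindep hlaw hB)

/-- The joint characteristic function of the numbers of points in finitely many sets. -/
theorem integral_exp_sum_limitPointProcess (hindep : iIndepFun E P)
    (hlaw : ∀ i, HasLaw (E i) (expMeasure 1) P) {ι : Type*} [Fintype ι] (t : ι → ℝ)
    {B : ι → Set UpperReal} (hB : ∀ j, MeasurableSet (B j)) (hm : ∀ j, expIntensity (B j) ≠ ⊤) :
    ∫ ω, Complex.exp ((∑ j, t j * (limitPointProcess E ω).toMeasure.real (B j) : ℝ) * Complex.I) ∂P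
      = Complex.exp (-∫ y, (1 - indicatorChar t B y) ∂expIntensity) := by
  have h1 := tendsto_integral_prod_negLog hindep hlaw (measurable_indicatorChar t hB)
    (fun y => (norm_indicatorChar t B y).le) (integrable_one_sub_indicatorChar t hB hm)
  refine tendsto_nhds_unique ?_ h1
  refine tendsto_integral_of_dominated_convergence (fun _ => 1) (fun n => ?_)
    (integrable_const _) (fun n => Eventually.of_forall fun ω => ?_) ?_
  · exact (Finset.aemeasurable_fun_prod _ fun i _ =>
      ((measurable_indicatorChar t hB).comp measurable_negLog).comp_aemeasurable
        (aemeasurable_partialSum (fun i => (hlaw i).aemeasurable) _)).aestronglyMeasurable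
  · rw [norm_prod]
    exact Finset.prod_le_one (fun _ _ => norm_nonneg _) fun _ _ => (norm_indicatorChar t B _).le
  -- Finiteness is needed because `Measure.real` gives the value `0` to infinite mass, which is not
  -- the limit of the partial counts.
  · filter_upwards [ae_limitPointProcess_eq hindep hlaw,
      ae_all_iff.2 fun j => ae_limitPointProcess_ne_top hindep hlaw (hB j) (hm j)] with ω hω hfin
    simp_rw [prod_indicatorChar]
    have h2 : Tendsto (fun n => ∑ j, t j * countBefore (B j)
        (fun i => negLog (partialSum E (i + 1) ω)) n) atTop
        (𝓝 (∑ j, t j * (limitPointProcess E ω).toMeasure.real (B j))) := by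
      refine tendsto_finsetSum _ fun j _ => Tendsto.const_mul _ ?_
      have h3 := hfin j
      rw [hω] at h3
      rw [Measure.real, hω]
      exact tendsto_countBefore (hB j) _ h3
    have hc : Continuous fun x : ℝ => Complex.exp (x * Complex.I) := by fun_prop
    exact (hc.tendsto _).comp h2

theorem charFun_limitPointProcess_real (hindep : iIndepFun E P)
    (hlaw : ∀ i, HasLaw (E i) (expMeasure 1) P) {B : Set UpperReal} (hB : MeasurableSet B)
    (hm : expIntensity B ≠ ⊤) (s : ℝ) :
    charFun (P.map fun ω => (limitPointProcess E ω).toMeasure.real B) s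
      = Complex.exp (-((expIntensity.real B : ℂ) * (1 - Complex.exp (s * Complex.I)))) := by
  have h := integral_exp_sum_limitPointProcess hindep hlaw (fun _ : Unit => s)
    (B := fun _ => B) (fun _ => hB) (fun _ => hm)
  rw [integral_one_sub_indicatorChar _ (fun _ => hB) (fun _ => hm)
    (fun i j hij => absurd (Subsingleton.elim i j) hij)] at h
  simp only [Finset.univ_unique, Finset.sum_singleton] at h
  rw [← h, charFun_apply_real, integral_map (aemeasurable_limitPointProcess_real hindep hlaw hB)
    (by fun_prop)]
  simp

theorem map_limitPointProcess_real (hindep : iIndepFun E P)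
    (hlaw : ∀ i, HasLaw (E i) (expMeasure 1) P) {B : Set UpperReal} (hB : MeasurableSet B)
    (hm : expIntensity B ≠ ⊤) :
    P.map (fun ω => (limitPointProcess E ω).toMeasure.real B)
      = (poissonMeasure (expIntensity B).toNNReal).map (Nat.cast : ℕ → ℝ) := by
  have := Measure.isProbabilityMeasure_map
    (aemeasurable_limitPointProcess_real hindep hlaw hB (P := P))
  refine Measure.ext_of_charFun (funext fun s => ?_)
  rw [charFun_limitPointProcess_real hindep hlaw hB hm, charFun_map_cast_poissonMeasure]
  congr 1
  have : (((expIntensity B).toNNReal : ℝ) : ℂ) = (expIntensity.real B : ℂ) := rfl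
  rw [this]
  ring

theorem hasLaw_limitPointProcess (hindep : iIndepFun E P)
    (hlaw : ∀ i, HasLaw (E i) (expMeasure 1) P) {B : Set UpperReal} (hB : MeasurableSet B)
    (hm : expIntensity B ≠ ⊤) :
    HasLaw (fun ω => (limitPointProcess E ω).toMeasure B)
      ((poissonMeasure (expIntensity B).toNNReal).map (Nat.cast : ℕ → ENNReal)) P := by
  refine ⟨aemeasurable_limitPointProcess_apply hindep hlaw hB, ?_⟩
  have h1 : (fun ω => (limitPointProcess E ω).toMeasure B)
      =ᵐ[P] fun ω => ENNReal.ofReal ((limitPointProcess E ω).toMeasure.real B) := by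
    filter_upwards [ae_limitPointProcess_ne_top hindep hlaw hB hm] with ω hω
    rw [Measure.real, ENNReal.ofReal_toReal hω]
  have hr := aemeasurable_limitPointProcess_real hindep hlaw hB (P := P)
  rw [Measure.map_congr h1]
  have h2 := AEMeasurable.map_map_of_aemeasurable (μ := P) (g := ENNReal.ofReal)
    ENNReal.measurable_ofReal.aemeasurable hr
  rw [Function.comp_def] at h2
  rw [← h2, map_limitPointProcess_real hindep hlaw hB hm,
    Measure.map_map ENNReal.measurable_ofReal (by fun_prop)]
  congr 1
  funext k
  simp

/-- For disjoint sets the exponent of the joint characteristic function is a sum over the sets, so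
the function factorizes. -/
theorem iIndepFun_limitPointProcess_real (hindep : iIndepFun E P)
    (hlaw : ∀ i, HasLaw (E i) (expMeasure 1) P) {ι : Type*} [Fintype ι]
    {B : ι → Set UpperReal} (hB : ∀ j, MeasurableSet (B j)) (hm : ∀ j, expIntensity (B j) ≠ ⊤)
    (hd : Pairwise fun i j => Disjoint (B i) (B j)) :
    iIndepFun (fun j ω => (limitPointProcess E ω).toMeasure.real (B j)) P := by
  have hr := fun j => aemeasurable_limitPointProcess_real hindep hlaw (hB j) (P := P)
  rw [iIndepFun_iff_charFun_pi hr]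
  intro t
  simp_rw [charFun_limitPointProcess_real hindep hlaw (hB _) (hm _)]
  rw [← Complex.exp_sum, Finset.sum_neg_distrib, ← integral_one_sub_indicatorChar _ hB hm hd,
    ← integral_exp_sum_limitPointProcess hindep hlaw _ hB hm, charFun_apply,
    integral_map (by fun_prop) (by fun_prop)]
  simp [PiLp.inner_apply, mul_comm]

theorem iIndepFun_limitPointProcess (hindep : iIndepFun E P)
    (hlaw : ∀ i, HasLaw (E i) (expMeasure 1) P) {ι : Type*} [Fintype ι]
    {B : ι → Set UpperReal} (hB : ∀ j, MeasurableSet (B j))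
    (hd : Pairwise fun i j => Disjoint (B i) (B j)) :
    iIndepFun (fun j ω => (limitPointProcess E ω).toMeasure (B j)) P := by
  classical
  -- Counts of sets of infinite intensity are almost surely the constant `⊤`. They are replaced by
  -- the empty set here, and `φ` restores the constant.
  let A : ι → Set UpperReal := fun j => if expIntensity (B j) = ⊤ then ∅ else B j
  have hA : ∀ j, MeasurableSet (A j) := fun j => by
    by_cases h : expIntensity (B j) = ⊤ <;> simp [A, h, hB]
  have hAm : ∀ j, expIntensity (A j) ≠ ⊤ := fun j => by
    by_cases h : expIntensity (B j) = ⊤ <;> simp [A, h]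
  have hAB : ∀ j, A j ⊆ B j := fun j => by
    by_cases h : expIntensity (B j) = ⊤ <;> simp [A, h]
  have hind := iIndepFun_limitPointProcess_real hindep hlaw hA hAm
    fun i j hij => (hd hij).mono (hAB i) (hAB j)
  let φ : ι → ℝ → ENNReal := fun j => if expIntensity (B j) = ⊤ then fun _ => ⊤ else ENNReal.ofReal
  have hφ : ∀ j, Measurable (φ j) := fun j => by
    by_cases h : expIntensity (B j) = ⊤
    · simp [φ, h]
    · simpa [φ, h] using ENNReal.measurable_ofReal
  refine (hind.comp φ hφ).congr fun j => ?_
  by_cases h : expIntensity (B j) = ⊤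
  · filter_upwards [ae_limitPointProcess_eq_top hindep hlaw (hB j) h] with ω hω
    simp [φ, h, hω]
  · filter_upwards [ae_limitPointProcess_ne_top hindep hlaw (hB j) h] with ω hω
    simp [φ, A, h, Measure.real, ENNReal.ofReal_toReal hω]

theorem isPoissonRandomMeasure_limitPointProcess (hindep : iIndepFun E P)
    (hlaw : ∀ i, HasLaw (E i) (expMeasure 1) P) :
    IsPoissonRandomMeasure (limitPointProcess E) expIntensity P where
  hasLaw_of_lt_top _ hB hm := hasLaw_limitPointProcess hindep hlaw hB hm.ne
  ae_eq_top _ hB hm := ae_limitPointProcess_eq_top hindep hlaw hB hm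
  iIndepFun_of_disjoint _ _ hB hd := iIndepFun_limitPointProcess hindep hlaw hB hd

end Limit

/-! ### Approximation of test functions by steps -/

instance : LocallyCompactSpace UpperReal := isOpen_Ioi.locallyCompactSpace

/-- The half-line `(r, ∞]`. -/
def halfLine (r : ℝ) : Set UpperReal := Set.Ioi (toUpperReal r)

theorem measurableSet_halfLine (r : ℝ) : MeasurableSet (halfLine r) := measurableSet_Ioi

theorem isCompact_Ici_toUpperReal (r : ℝ) : IsCompact (Set.Ici (toUpperReal r)) := by
  rw [Topology.IsEmbedding.subtypeVal.isCompact_iff]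
  have h : (Subtype.val '' Set.Ici (toUpperReal r) : Set EReal) = Set.Icc (r : EReal) ⊤ := by
    ext y
    constructor
    · rintro ⟨z, hz, rfl⟩
      exact ⟨hz, le_top⟩
    · rintro ⟨hy, -⟩
      exact ⟨⟨y, (EReal.bot_lt_coe r).trans_le hy⟩, hy, rfl⟩
  rw [h]
  exact isCompact_Icc

theorem PointMeasure.measure_halfLine_ne_top (m : PointMeasure UpperReal) (r : ℝ) :
    m.toMeasure (halfLine r) ≠ ⊤ :=
  ((measure_mono Set.Ioi_subset_Ici_self).trans_lt
    (m.isPointMeasure.1 _ (isCompact_Ici_toUpperReal r))).ne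

theorem PointMeasure.exists_real_halfLine_eq (m : PointMeasure UpperReal) (r : ℝ) :
    ∃ k : ℕ, m.toMeasure.real (halfLine r) = k := by
  obtain ⟨k, hk⟩ := m.isPointMeasure.2 _ (measurableSet_halfLine r)
  have hfin := m.measure_halfLine_ne_top r
  rw [hk] at hfin
  have hk' : k ≠ ⊤ := by rintro rfl; simp at hfin
  lift k to ℕ using hk'
  exact ⟨k, by simp [Measure.real, hk]⟩

/-- The linear span of the indicators of half-lines `(r, ∞]` with rational `r`. -/
def halfLineSteps : Submodule ℝ (UpperReal → ℝ) :=
  Submodule.span ℝ (Set.range fun r : ℚ => (halfLine r).indicator 1)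

theorem indicator_halfLine_mem (r : ℚ) : (halfLine r).indicator 1 ∈ halfLineSteps :=
  Submodule.subset_span ⟨r, rfl⟩

theorem integrable_of_mem_halfLineSteps {h : UpperReal → ℝ} (hh : h ∈ halfLineSteps)
    (m : PointMeasure UpperReal) : Integrable h m.toMeasure := by
  induction hh using Submodule.span_induction with
  | mem h hr =>
    obtain ⟨r, rfl⟩ := hr
    exact (integrable_indicator_iff (measurableSet_halfLine r)).2
      (integrableOn_const (m.measure_halfLine_ne_top r))
  | zero => exact integrable_zero _ _ _
  | add f g _ _ hf hg => exact hf.add hg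
  | smul a f _ hf => exact hf.smul a

theorem exists_finset_integral_eq_of_mem_halfLineSteps {h : UpperReal → ℝ}
    (hh : h ∈ halfLineSteps) : ∃ L : Finset ℚ, ∀ m m' : PointMeasure UpperReal,
      (∀ r ∈ L, m'.toMeasure.real (halfLine r) = m.toMeasure.real (halfLine r)) →
        ∫ y, h y ∂m'.toMeasure = ∫ y, h y ∂m.toMeasure := by
  classical
  induction hh using Submodule.span_induction with
  | mem h hr =>
    obtain ⟨r, rfl⟩ := hr
    refine ⟨{r}, fun m m' hm => ?_⟩
    simp only [integral_indicator_one (measurableSet_halfLine r)]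
    exact hm r (by simp)
  | zero => exact ⟨∅, by simp⟩
  | add f g hf' hg' hf hg =>
    obtain ⟨L1, h1⟩ := hf
    obtain ⟨L2, h2⟩ := hg
    refine ⟨L1 ∪ L2, fun m m' hm => ?_⟩
    simp only [Pi.add_apply]
    rw [integral_add (integrable_of_mem_halfLineSteps hf' m') (integrable_of_mem_halfLineSteps hg' m'),
      integral_add (integrable_of_mem_halfLineSteps hf' m) (integrable_of_mem_halfLineSteps hg' m),
      h1 m m' fun r hr => hm r (Finset.mem_union_left _ hr),
      h2 m m' fun r hr => hm r (Finset.mem_union_right _ hr)]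
  | smul a f _ hf =>
    obtain ⟨L, h⟩ := hf
    refine ⟨L, fun m m' hm => ?_⟩
    simp only [Pi.smul_apply, integral_smul, h m m' hm]

theorem continuous_toUpperReal : Continuous toUpperReal :=
  continuous_coe_real_ereal.subtype_mk _

/-- Continuity at the point `∞` of the state space leaves only a bounded interval to be subdivided.
-/
theorem exists_rat_forall_lt_abs_sub_le {f : UpperReal → ℝ} (hf : Continuous f) {δ : ℝ}
    (hδ : 0 < δ) (c : ℚ) : ∃ M : ℚ, c < M ∧ ∃ a : ℝ, ∀ y ∈ halfLine M, |f y - a| ≤ δ := by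
  let top : UpperReal := ⟨⊤, Set.mem_Ioi.2 bot_lt_top⟩
  have h1 : ∀ᶠ y in 𝓝 top, |f y - f top| < δ := Metric.continuousAt_iff'.1 hf.continuousAt δ hδ
  rw [nhds_subtype_eq_comap, eventually_comap] at h1
  obtain ⟨x, hx⟩ := EReal.mem_nhds_top_iff.1 h1
  obtain ⟨M, hM⟩ := exists_rat_gt (max x c)
  refine ⟨M, by exact_mod_cast (le_max_right x c).trans_lt hM, f top, fun y hy => ?_⟩
  refine (hx (?_ : (y : EReal) ∈ Set.Ioi (x : EReal)) y rfl).le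
  exact (EReal.coe_lt_coe_iff.2 ((le_max_left x c).trans_lt hM)).trans hy

/-- On the new piece `(x', x]` the step function takes the value of `f` at the right endpoint. -/
theorem exists_step_extend {f h : UpperReal → ℝ} {δ : ℝ} {x x' : ℚ} (hxx : x' ≤ x)
    (hh : h ∈ halfLineSteps) (h0 : ∀ y ∉ halfLine x, h y = 0)
    (h1 : ∀ y ∈ halfLine x, |f y - h y| ≤ δ)
    (hosc : ∀ z : ℝ, x' ≤ z → z ≤ x → |f (toUpperReal z) - f (toUpperReal x)| ≤ δ) :
    ∃ h' ∈ halfLineSteps, (∀ y ∉ halfLine x', h' y = 0) ∧ ∀ y ∈ halfLine x', |f y - h' y| ≤ δ := by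
  have hsub : halfLine x ⊆ halfLine x' :=
    Set.Ioi_subset_Ioi (EReal.coe_le_coe_iff.2 (by exact_mod_cast hxx))
  refine ⟨h + f (toUpperReal x) • ((halfLine x').indicator 1 - (halfLine x).indicator 1),
    add_mem hh (Submodule.smul_mem _ _ (sub_mem (indicator_halfLine_mem x')
      (indicator_halfLine_mem x))), fun y hy => ?_, fun y hy => ?_⟩
  · have hy' : y ∉ halfLine x := fun h => hy (hsub h)
    simp [h0 y hy', hy, hy']
  · by_cases hy' : y ∈ halfLine x
    · simpa [hy, hy'] using h1 y hy'
    · obtain ⟨z, hz⟩ : ∃ z : ℝ, y = toUpperReal z := by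
        have hyx : (y : EReal) ≤ ((x : ℝ) : EReal) := not_lt.1 hy'
        have hyt : (y : EReal) ≠ ⊤ := (hyx.trans_lt (EReal.coe_lt_top _)).ne
        exact ⟨(y : EReal).toReal, Subtype.ext (EReal.coe_toReal hyt y.2.ne').symm⟩
      subst hz
      have hz1 : (x' : ℝ) < z := EReal.coe_lt_coe_iff.1 hy
      have hz2 : z ≤ x := EReal.coe_le_coe_iff.1 (not_lt.1 hy')
      simpa [hy, hy', h0 _ hy'] using hosc z hz1.le hz2

theorem exists_step_approx {f : UpperReal → ℝ} (hf : Continuous f) (c : ℚ) {δ : ℝ} (hδ : 0 < δ) :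
    ∃ h ∈ halfLineSteps, (∀ y ∉ halfLine c, h y = 0) ∧ ∀ y ∈ halfLine c, |f y - h y| ≤ δ := by
  obtain ⟨M, hcM, a, hM⟩ := exists_rat_forall_lt_abs_sub_le hf hδ c
  have huc := isCompact_Icc.uniformContinuousOn_of_continuous
    ((hf.comp continuous_toUpperReal).continuousOn (s := Set.Icc (c : ℝ) M))
  obtain ⟨η, hη, hosc⟩ := Metric.uniformContinuousOn_iff.1 huc δ hδ
  obtain ⟨n, hn⟩ := exists_nat_gt (((M : ℝ) - c) / η)
  have hcM' : (c : ℝ) < M := by exact_mod_cast hcM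
  have hn0 : (0 : ℝ) < n := (div_pos (sub_pos.2 hcM') hη).trans hn
  have hn0' : (0 : ℚ) < n := by exact_mod_cast hn0
  -- The grid runs downwards from `M` to `c`, with mesh below the modulus of continuity `η`.
  let x : ℕ → ℚ := fun l => M - l * ((M - c) / n)
  have hstep : ((M : ℝ) - c) / n < η := by
    rw [div_lt_iff₀ hη] at hn
    rw [div_lt_iff₀ hn0]
    linarith
  have hstep0 : 0 ≤ (M - c) / n := div_nonneg (sub_nonneg.2 hcM.le) hn0'.le
  have hxn : x n = c := by
    simp only [x]
    field_simp
    ring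
  have hxanti : Antitone x := fun k l hkl => by
    have hkl' : (k : ℚ) ≤ l := by exact_mod_cast hkl
    simp only [x]
    nlinarith
  have key : ∀ l ≤ n, ∃ h ∈ halfLineSteps, (∀ y ∉ halfLine (x l), h y = 0) ∧
      ∀ y ∈ halfLine (x l), |f y - h y| ≤ δ := by
    intro l
    induction l with
    | zero =>
      intro _
      have hx0 : x 0 = M := by simp [x]
      rw [hx0]
      refine ⟨a • (halfLine M).indicator 1, Submodule.smul_mem _ _ (indicator_halfLine_mem M),
        fun y hy => by simp [hy], fun y hy => by simpa [hy] using hM y hy⟩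
    | succ l ih =>
      intro hl
      obtain ⟨h, hh, h0, h1⟩ := ih (Nat.le_of_succ_le hl)
      have hc1 : c ≤ x (l + 1) := hxn ▸ hxanti hl
      have hM1 : x l ≤ M := by simpa [x] using hxanti (Nat.zero_le l)
      have hc1' : (c : ℝ) ≤ x (l + 1) := by exact_mod_cast hc1
      have hM1' : (x l : ℝ) ≤ M := by exact_mod_cast hM1
      have hxx : (x (l + 1) : ℝ) ≤ x l := by exact_mod_cast hxanti (Nat.le_succ l)
      have hdiff : (x l : ℝ) - x (l + 1) = ((M : ℝ) - c) / n := by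
        simp only [x]
        push_cast
        ring
      refine exists_step_extend (hxanti (Nat.le_succ l)) hh h0 h1 fun z hz1 hz2 => ?_
      refine (hosc z ⟨hc1'.trans hz1, hz2.trans hM1'⟩ (x l) ⟨hc1'.trans hxx, hM1'⟩ ?_).le
      rw [Real.dist_eq, abs_of_nonpos (by linarith)]
      linarith
  simpa only [hxn] using key n le_rfl

/-- Replace `f` by a uniformly close step function supported on the same half-line `(c, ∞]`. Equal
counts give equal integrals of the step function, and the error is at most `δ` times the mass of
`(c, ∞]`, for each measure. -/
theorem exists_finset_abs_integral_sub_lt (f : CompactlySupportedContinuousMap UpperReal ℝ)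
    (m : PointMeasure UpperReal) {ε : ℝ} (hε : 0 < ε) :
    ∃ L : Finset ℚ, ∀ m' : PointMeasure UpperReal,
      (∀ r ∈ L, m'.toMeasure.real (halfLine r) = m.toMeasure.real (halfLine r)) →
        |∫ y, f y ∂m'.toMeasure - ∫ y, f y ∂m.toMeasure| < ε := by
  classical
  obtain ⟨c', hc'⟩ := exists_subset_Ioi_of_isCompact f.hasCompactSupport
  obtain ⟨c, hc⟩ := exists_rat_lt c'
  have hf0 : ∀ y ∉ halfLine c, f y = 0 := by
    intro y hy
    by_contra h
    refine hy (Set.Ioi_subset_Ioi (EReal.coe_le_coe_iff.2 hc.le) (hc' ?_))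
    exact subset_tsupport _ h
  set q := m.toMeasure.real (halfLine c) with hq
  have hq0 : 0 ≤ q := measureReal_nonneg
  set δ := ε / (2 * (q + 1)) with hδ
  have hδ0 : 0 < δ := by positivity
  obtain ⟨h, hh, h0, h1⟩ := exists_step_approx f.continuous c hδ0
  obtain ⟨L, hL⟩ := exists_finset_integral_eq_of_mem_halfLineSteps hh
  have hfi : ∀ m' : PointMeasure UpperReal, Integrable f m'.toMeasure := by
    intro m'
    have : IsFiniteMeasureOnCompacts m'.toMeasure := ⟨fun K hK => m'.isPointMeasure.1 K hK⟩
    exact f.continuous.integrable_of_hasCompactSupport f.hasCompactSupport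
  have hbound : ∀ m' : PointMeasure UpperReal, m'.toMeasure.real (halfLine c) = q →
      |∫ y, f y ∂m'.toMeasure - ∫ y, h y ∂m'.toMeasure| ≤ δ * q := by
    intro m' hm'
    rw [← integral_sub (hfi m') (integrable_of_mem_halfLineSteps hh m')]
    have hle : ∀ y, ‖f y - h y‖ ≤ (halfLine c).indicator (fun _ => δ) y := by
      intro y
      by_cases hy : y ∈ halfLine c
      · simpa [hy] using h1 y hy
      · simp [hy, hf0 y hy, h0 y hy]
    refine (norm_integral_le_of_norm_le ?_ (Eventually.of_forall hle)).trans ?_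
    · exact (integrable_indicator_iff (measurableSet_halfLine c)).2
        (integrableOn_const (m'.measure_halfLine_ne_top c))
    · rw [integral_indicator_const _ (measurableSet_halfLine c), hm', smul_eq_mul, mul_comm]
  -- Including `c` gives `m'` the same mass `q` on `(c, ∞]`, so one `δ` controls both errors.
  refine ⟨insert c L, fun m' hm' => ?_⟩
  have e1 := hbound m' (hm' c (Finset.mem_insert_self _ _))
  have e2 := hbound m rfl
  rw [hL m m' fun r hr => hm' r (Finset.mem_insert_of_mem hr)] at e1
  have e3 : 2 * (δ * q) < ε := by
    have : δ * (2 * (q + 1)) = ε := div_mul_cancel₀ _ (by positivity)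
    nlinarith
  rw [abs_le] at e1 e2
  rw [abs_lt]
  constructor <;> linarith

/-! ### Open sets in terms of the numbers of points in half-lines -/

/-- An enumeration of the rational numbers. -/
def ratSeq (i : ℕ) : ℚ := (Denumerable.eqv ℚ).symm i

/-- The numbers of points in the first `j` half-lines `(r, ∞]` with rational `r`. -/
def halfLineCounts (j : ℕ) (m : PointMeasure UpperReal) : EuclideanSpace ℝ (Fin j) :=
  WithLp.toLp 2 fun i => m.toMeasure.real (halfLine (ratSeq i))

theorem exists_halfLineCounts_fiber_subset {U : Set (PointMeasure UpperReal)} (hU : IsOpen U)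
    {m : PointMeasure UpperReal} (hm : m ∈ U) :
    ∃ j, {m' | halfLineCounts j m' = halfLineCounts j m} ⊆ U := by
  let A : ℕ → Set (PointMeasure UpperReal) := fun j =>
    {m' | halfLineCounts j m' = halfLineCounts j m}
  have hcoord : ∀ {j m'}, m' ∈ A j → ∀ i < j,
      m'.toMeasure.real (halfLine (ratSeq i)) = m.toMeasure.real (halfLine (ratSeq i)) := by
    intro j m' h i hi
    exact congrArg (fun v : EuclideanSpace ℝ (Fin j) => v ⟨i, hi⟩) h
  have hA : Antitone A := by
    intro j k hjk m' h
    refine PiLp.ext fun i => ?_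
    exact hcoord h i (i.2.trans_le hjk)
  have hb : (⨅ j, 𝓟 (A j)).HasBasis (fun _ => True) A := hasBasis_iInf_principal hA.directed_ge
  -- The filter generated by the fibres of the counts is finer than the vague neighbourhood filter;
  -- it suffices to test the integrals of compactly supported functions.
  have hle : ⨅ j, 𝓟 (A j) ≤ 𝓝 m := by
    rw [nhds_induced, ← tendsto_iff_comap, tendsto_pi_nhds]
    intro f
    refine Metric.tendsto_nhds.2 fun ε hε => ?_
    obtain ⟨L, hL⟩ := exists_finset_abs_integral_sub_lt f m hε
    refine hb.eventually_iff.2 ⟨L.sup (fun r => Denumerable.eqv ℚ r) + 1, trivial, fun m' hm' => ?_⟩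
    refine hL m' fun r hr => ?_
    have h := hcoord hm' (Denumerable.eqv ℚ r)
      (Nat.lt_succ_of_le (Finset.le_sup (f := fun r => Denumerable.eqv ℚ r) hr))
    simpa [ratSeq] using h
  obtain ⟨j, -, hj⟩ := hb.mem_iff.1 (hle (hU.mem_nhds hm))
  exact ⟨j, hj⟩

/-- The coordinates are integers. -/
theorem halfLineCounts_eq_of_dist_lt_one {j : ℕ} {m m' : PointMeasure UpperReal}
    (h : dist (halfLineCounts j m) (halfLineCounts j m') < 1) :
    halfLineCounts j m = halfLineCounts j m' := by
  refine PiLp.ext fun i => ?_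
  have h1 : ‖(halfLineCounts j m - halfLineCounts j m') i‖ < 1 :=
    (PiLp.norm_apply_le _ i).trans_lt (by rwa [← dist_eq_norm])
  obtain ⟨k, hk⟩ := m.exists_real_halfLine_eq (ratSeq i)
  obtain ⟨k', hk'⟩ := m'.exists_real_halfLine_eq (ratSeq i)
  have e1 : halfLineCounts j m i = k := hk
  have e2 : halfLineCounts j m' i = k' := hk'
  rw [PiLp.sub_apply, e1, e2, Real.norm_eq_abs] at h1
  have h2 : |(k : ℤ) - k'| < 1 := by exact_mod_cast h1
  rw [Int.abs_lt_one_iff, sub_eq_zero] at h2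
  rw [e1, e2]
  exact_mod_cast h2

/-- Every vaguely open set is the increasing union of open conditions on the numbers of points in
finitely many half-lines. -/
theorem exists_isOpen_eq_iUnion_preimage {U : Set (PointMeasure UpperReal)} (hU : IsOpen U) :
    ∃ V : ∀ j, Set (EuclideanSpace ℝ (Fin j)), (∀ j, IsOpen (V j)) ∧
      Monotone (fun j => halfLineCounts j ⁻¹' V j) ∧ U = ⋃ j, halfLineCounts j ⁻¹' V j := by
  let W : ℕ → Set (PointMeasure UpperReal) := fun j =>
    {m | {m' | halfLineCounts j m' = halfLineCounts j m} ⊆ U}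
  -- By integrality a unit ball around a count vector contains no other count vector, so fibres
  -- become preimages of open sets.
  let V : ∀ j, Set (EuclideanSpace ℝ (Fin j)) := fun j =>
    ⋃ m ∈ W j, Metric.ball (halfLineCounts j m) 1
  have hVW : ∀ j, halfLineCounts j ⁻¹' V j = W j := by
    intro j
    ext m
    simp only [V, Set.mem_preimage, Set.mem_iUnion, Metric.mem_ball, exists_prop]
    constructor
    · rintro ⟨m', hm', hd⟩
      have := halfLineCounts_eq_of_dist_lt_one hd
      change {m'' | halfLineCounts j m'' = halfLineCounts j m} ⊆ U
      rwa [this]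
    · exact fun hm => ⟨m, hm, by simp⟩
  refine ⟨V, fun j => isOpen_biUnion fun _ _ => Metric.isOpen_ball, ?_, ?_⟩
  · simp_rw [hVW]
    intro j k hjk m hm m' hm'
    refine hm (PiLp.ext fun i => ?_)
    exact congrArg (fun v : EuclideanSpace ℝ (Fin k) => v ⟨i, i.2.trans_le hjk⟩) hm'
  · simp_rw [hVW]
    ext m
    simp only [Set.mem_iUnion]
    exact ⟨fun hm => exists_halfLineCounts_fiber_subset hU hm, fun ⟨j, hj⟩ => hj rfl⟩

theorem measurable_of_measurable_halfLineCounts {Ω : Type*} [MeasurableSpace Ω]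
    {N : Ω → PointMeasure UpperReal} (h : ∀ j, Measurable fun ω => halfLineCounts j (N ω)) :
    Measurable N := by
  refine measurable_of_isOpen fun U hU => ?_
  obtain ⟨V, hV, -, rfl⟩ := exists_isOpen_eq_iUnion_preimage hU
  rw [Set.preimage_iUnion]
  exact MeasurableSet.iUnion fun j => h j (hV j).measurableSet

theorem aemeasurable_of_aemeasurable_halfLine {Ω : Type*} [MeasurableSpace Ω] {P : Measure Ω}
    {N : Ω → PointMeasure UpperReal}
    (h : ∀ r : ℝ, AEMeasurable (fun ω => (N ω).toMeasure.real (halfLine r)) P) :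
    AEMeasurable N P := by
  classical
  have hall : ∀ᵐ ω ∂P, ∀ i, (N ω).toMeasure.real (halfLine (ratSeq i)) = (h (ratSeq i)).mk _ ω :=
    ae_all_iff.2 fun i => (h (ratSeq i)).ae_eq_mk
  obtain ⟨A, hA, hAm, hA0⟩ := exists_measurable_superset_of_null hall
  let z : PointMeasure UpperReal := ⟨0, isPointMeasure_zero _⟩
  -- `N` is set to the zero measure on a null set outside which the countably many rational counts
  -- agree with their measurable versions.
  refine ⟨A.piecewise (fun _ => z) N, measurable_of_measurable_halfLineCounts fun j => ?_, ?_⟩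
  · refine (WithLp.measurable_toLp 2 _).comp (measurable_pi_lambda _ fun i => ?_)
    have heq : (fun ω => (A.piecewise (fun _ => z) N ω).toMeasure.real (halfLine (ratSeq i)))
        = A.piecewise (fun _ => z.toMeasure.real (halfLine (ratSeq i)))
          ((h (ratSeq i)).mk _) := by
      funext ω
      by_cases hω : ω ∈ A
      · simp [hω]
      · have : ω ∉ {ω | ¬∀ i, (N ω).toMeasure.real (halfLine (ratSeq i)) = (h (ratSeq i)).mk _ ω} :=
          fun h' => hω (hA h')
        simp only [Set.mem_ofPred_eq, not_not] at this
        simp [hω, this i]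
    rw [heq]
    exact Measurable.piecewise hAm measurable_const (h (ratSeq i)).measurable_mk
  · filter_upwards [compl_mem_ae_iff.2 hA0] with ω hω
    rw [Set.piecewise_eq_of_notMem _ _ _ hω]

theorem aemeasurable_halfLineCounts {Ω : Type*} [MeasurableSpace Ω] {P : Measure Ω}
    {N : Ω → PointMeasure UpperReal}
    (h : ∀ r : ℝ, AEMeasurable (fun ω => (N ω).toMeasure.real (halfLine r)) P) (j : ℕ) :
    AEMeasurable (fun ω => halfLineCounts j (N ω)) P :=
  (WithLp.measurable_toLp 2 _).comp_aemeasurable (aemeasurable_pi_lambda _ fun i => h (ratSeq i))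

/-- Convergence in distribution of point processes follows from the convergence of the joint
characteristic functions of the numbers of points in half-lines. -/
theorem tendstoInDistribution_of_tendsto_halfLine {Ω Ω' : Type*} [MeasurableSpace Ω]
    [MeasurableSpace Ω'] {P : Measure Ω} [IsProbabilityMeasure P] {P' : Measure Ω'}
    [IsProbabilityMeasure P'] {N : ℕ → Ω → PointMeasure UpperReal}
    {N' : Ω' → PointMeasure UpperReal}
    (hN : ∀ n, ∀ r : ℝ, AEMeasurable (fun ω => (N n ω).toMeasure.real (halfLine r)) P)
    (hN' : ∀ r : ℝ, AEMeasurable (fun ω => (N' ω).toMeasure.real (halfLine r)) P')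
    (hlim : ∀ (j : ℕ) (r t : Fin j → ℝ), Tendsto (fun n => ∫ ω, Complex.exp
        ((∑ i, t i * (N n ω).toMeasure.real (halfLine (r i)) : ℝ) * Complex.I) ∂P) atTop
      (𝓝 (∫ ω, Complex.exp
        ((∑ i, t i * (N' ω).toMeasure.real (halfLine (r i)) : ℝ) * Complex.I) ∂P'))) :
    TendstoInDistribution N atTop N' (fun _ => P) P' := by
  have hNm : ∀ n, AEMeasurable (N n) P := fun n => aemeasurable_of_aemeasurable_halfLine (hN n)
  have hNm' : AEMeasurable N' P' := aemeasurable_of_aemeasurable_halfLine hN'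
  refine ⟨hNm, hNm', ?_⟩
  refine tendsto_of_forall_isOpen_le_liminf' fun U hU => ?_
  obtain ⟨V, hV, hmono, hUV⟩ := exists_isOpen_eq_iUnion_preimage hU
  simp only [ProbabilityMeasure.coe_mk]
  have hc := fun n j => aemeasurable_halfLineCounts (hN n) j
  have hc' := fun j => aemeasurable_halfLineCounts hN' j
  -- For fixed `j` this is Lévy's continuity theorem followed by the portmanteau theorem in finite
  -- dimension. Continuity of measure from below then passes to `U`.
  have hcyl : ∀ j, P' (N' ⁻¹' (halfLineCounts j ⁻¹' V j))
      ≤ atTop.liminf fun n => P (N n ⁻¹' (halfLineCounts j ⁻¹' V j)) := by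
    intro j
    let μ : ℕ → ProbabilityMeasure (EuclideanSpace ℝ (Fin j)) := fun n =>
      ⟨P.map fun ω => halfLineCounts j (N n ω), Measure.isProbabilityMeasure_map (hc n j)⟩
    let μ' : ProbabilityMeasure (EuclideanSpace ℝ (Fin j)) :=
      ⟨P'.map fun ω => halfLineCounts j (N' ω), Measure.isProbabilityMeasure_map (hc' j)⟩
    have hconv : Tendsto μ atTop (𝓝 μ') := by
      refine ProbabilityMeasure.tendsto_of_tendsto_charFun fun t => ?_
      have h := hlim j (fun i => ratSeq i) t
      simp only [μ, μ', ProbabilityMeasure.coe_mk, charFun_apply]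
      rw [integral_map (hc' j) (by fun_prop)]
      simp_rw [integral_map (hc _ j)
        (f := fun x : EuclideanSpace ℝ (Fin j) => Complex.exp (inner ℝ x t * Complex.I))
        (by fun_prop)]
      simpa [PiLp.inner_apply, halfLineCounts] using h
    have h := ProbabilityMeasure.le_liminf_measure_open_of_tendsto hconv (hV j)
    simp only [μ, μ', ProbabilityMeasure.coe_mk] at h
    rw [Measure.map_apply_of_aemeasurable (hc' j) (hV j).measurableSet] at h
    simp_rw [Measure.map_apply_of_aemeasurable (hc _ j) (hV j).measurableSet] at h
    exact h
  rw [Measure.map_apply_of_aemeasurable hNm' hU.measurableSet]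
  simp_rw [Measure.map_apply_of_aemeasurable (hNm _) hU.measurableSet]
  have hUj : ∀ j, halfLineCounts j ⁻¹' V j ⊆ U := fun j => by
    rw [hUV]
    exact Set.subset_iUnion (fun j => halfLineCounts j ⁻¹' V j) j
  have hU' : N' ⁻¹' U = ⋃ j, N' ⁻¹' (halfLineCounts j ⁻¹' V j) := by
    rw [hUV, Set.preimage_iUnion]
  have hmono' : Monotone fun j => N' ⁻¹' (halfLineCounts j ⁻¹' V j) :=
    fun j k hjk => Set.preimage_mono (hmono hjk)
  rw [hU', hmono'.measure_iUnion]
  refine iSup_le fun j => (hcyl j).trans ?_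
  exact liminf_le_liminf (Eventually.of_forall fun n => measure_mono (Set.preimage_mono (hUj j)))

/-! ### Powers close to one -/

/-- Here `a n → 0`, and `log (1 + a) - a` is quadratic in `a`, so it stays negligible after
multiplication by `p`. -/
theorem tendsto_one_add_pow_of_tendsto_mul {p : ℕ → ℕ} (hp : Tendsto p atTop atTop) {a : ℕ → ℂ}
    {c : ℂ} (h : Tendsto (fun n => (p n : ℂ) * a n) atTop (𝓝 c)) :
    Tendsto (fun n => (1 + a n) ^ p n) atTop (𝓝 (Complex.exp c)) := by
  have hpR : Tendsto (fun n => (p n : ℝ)) atTop atTop := tendsto_natCast_atTop_atTop.comp hp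
  have hpos := hp.eventually_gt_atTop 0
  have ha : Tendsto (fun n => ‖a n‖) atTop (𝓝 0) := by
    refine (h.norm.div_atTop hpR).congr' ?_
    filter_upwards [hpos] with n hn
    have : (p n : ℝ) ≠ 0 := by positivity
    rw [norm_mul, Complex.norm_natCast, mul_div_cancel_left₀ _ this]
  have hlt : ∀ᶠ n in atTop, ‖a n‖ < 1 := ha.eventually_lt_const one_pos
  have herr : Tendsto (fun n => (p n : ℂ) * (Complex.log (1 + a n) - a n)) atTop (𝓝 0) := by
    have h1 : Tendsto (fun n => ‖(p n : ℂ) * a n‖ * ‖a n‖ * (1 - ‖a n‖)⁻¹ / 2) atTop (𝓝 0) := by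
      simpa using ((h.norm.mul ha).mul ((ha.const_sub 1).inv₀ (by simp))).div_const 2
    refine squeeze_zero_norm' ?_ h1
    filter_upwards [hlt] with n hn
    rw [norm_mul, norm_mul]
    have h2 := mul_le_mul_of_nonneg_left (Complex.norm_log_one_add_sub_self_le hn)
      (norm_nonneg (p n : ℂ))
    refine h2.trans (le_of_eq ?_)
    ring
  have hlog : Tendsto (fun n => (p n : ℂ) * Complex.log (1 + a n)) atTop (𝓝 c) := by
    have h1 := herr.add h
    rw [zero_add] at h1
    refine h1.congr fun n => ?_
    ring
  refine ((Complex.continuous_exp.tendsto c).comp hlog).congr' ?_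
  filter_upwards [hlt] with n hn
  have h0 : 1 + a n ≠ 0 := by
    intro h0
    have : a n = -1 := by linear_combination h0
    simp [this] at hn
  rw [Function.comp_apply, Complex.exp_nat_mul, Complex.exp_log h0]

/-- Take logarithms and use `(1 - q) (-log (1 - q)) ≤ q ≤ -log (1 - q)`. -/
theorem tendsto_mul_of_tendsto_one_sub_pow {p : ℕ → ℕ} (hp : Tendsto p atTop atTop) {q : ℕ → ℝ}
    (hq1 : ∀ n, q n ≤ 1) {l : ℝ}
    (h : Tendsto (fun n => (1 - q n) ^ p n) atTop (𝓝 (Real.exp (-l)))) :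
    Tendsto (fun n => (p n : ℝ) * q n) atTop (𝓝 l) := by
  have hpR : Tendsto (fun n => (p n : ℝ)) atTop atTop := tendsto_natCast_atTop_atTop.comp hp
  have hpos := hp.eventually_gt_atTop 0
  have hlog : Tendsto (fun n => (p n : ℝ) * -Real.log (1 - q n)) atTop (𝓝 l) := by
    have h1 := ((Real.continuousAt_log (Real.exp_ne_zero (-l))).tendsto.comp h).neg
    rw [Real.log_exp, neg_neg] at h1
    refine h1.congr fun n => ?_
    rw [Function.comp_apply, Real.log_pow]
    ring
  have hlog0 : Tendsto (fun n => -Real.log (1 - q n)) atTop (𝓝 0) := by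
    refine (hlog.div_atTop hpR).congr' ?_
    filter_upwards [hpos] with n hn
    have : (p n : ℝ) ≠ 0 := by positivity
    rw [mul_div_cancel_left₀ _ this]
  -- If `1 - q n = 0` the power would vanish, whereas the limit is positive; this excludes the
  -- default `log 0 = 0`.
  have hlt : ∀ᶠ n in atTop, 0 < 1 - q n := by
    filter_upwards [h.eventually_const_lt (Real.exp_pos _), hpos] with n hn hpn
    rcases (sub_nonneg.2 (hq1 n)).eq_or_lt with h0 | h0
    · rw [← h0, zero_pow hpn.ne'] at hn
      exact absurd hn (lt_irrefl _)
    · exact h0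
  have h1q : Tendsto (fun n => 1 - q n) atTop (𝓝 1) := by
    have h1 := (Real.continuous_exp.tendsto _).comp hlog0.neg
    rw [neg_zero, Real.exp_zero] at h1
    refine h1.congr' ?_
    filter_upwards [hlt] with n hn
    rw [Function.comp_apply, neg_neg, Real.exp_log hn]
  refine tendsto_of_tendsto_of_tendsto_of_le_of_le' (by simpa using h1q.mul hlog) hlog ?_ ?_
  · filter_upwards [hlt] with n hn
    have h2 := Real.one_sub_inv_le_log_of_pos hn
    have h3 : (1 - q n) * -Real.log (1 - q n) ≤ q n := by
      have := mul_le_mul_of_nonneg_left h2 hn.le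
      rw [mul_sub, mul_one, mul_inv_cancel₀ hn.ne'] at this
      linarith
    refine le_trans (le_of_eq ?_) (mul_le_mul_of_nonneg_left h3 (Nat.cast_nonneg (p n)))
    ring
  · filter_upwards [hlt] with n hn
    have h2 := Real.log_le_sub_one_of_pos hn
    exact mul_le_mul_of_nonneg_left (by linarith) (Nat.cast_nonneg _)

/-! ### Characters of half-lines -/

/-- Expand the product of the factors `1 + (exp (i tⱼ) - 1) 1_{Bⱼ}`; the empty subset cancels the
leading `1`. For half-lines every remaining intersection is again a half-line, so tail asymptotics
suffice. -/
theorem one_sub_indicatorChar_eq_sum {ι E : Type*} [Fintype ι] [DecidableEq ι] (t : ι → ℝ)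
    (B : ι → Set E) (y : E) :
    1 - indicatorChar t B y = -∑ s ∈ Finset.univ.powerset.erase ∅,
      (⋂ j ∈ s, B j).indicator (fun _ => ∏ j ∈ s, (Complex.exp (t j * Complex.I) - 1)) y := by
  have h1 : indicatorChar t B y = ∏ j, (1 + (B j).indicator
      (fun _ => Complex.exp (t j * Complex.I) - 1) y) := by
    rw [indicatorChar, Complex.ofReal_sum, Finset.sum_mul, Complex.exp_sum]
    refine Finset.prod_congr rfl fun j _ => ?_
    by_cases h : y ∈ B j <;> simp [h]
  have h2 : ∀ s : Finset ι, (∏ j ∈ s, (B j).indicator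
      (fun _ => Complex.exp (t j * Complex.I) - 1) y) = (⋂ j ∈ s, B j).indicator
      (fun _ => ∏ j ∈ s, (Complex.exp (t j * Complex.I) - 1)) y := by
    intro s
    by_cases h : ∀ j ∈ s, y ∈ B j
    · rw [Set.indicator_of_mem (by simpa using h)]
      exact Finset.prod_congr rfl fun j hj => Set.indicator_of_mem (h j hj) _
    · rw [Set.indicator_of_notMem (by simpa using h)]
      push Not at h
      obtain ⟨j, hj, hy⟩ := h
      exact Finset.prod_eq_zero hj (Set.indicator_of_notMem hy _)
  rw [h1, Finset.prod_one_add, ← Finset.add_sum_erase _ _ (Finset.empty_mem_powerset _)]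
  simp_rw [h2]
  simp

theorem exists_iInter_halfLine_eq {ι : Type*} (r : ι → ℝ) {s : Finset ι} (hs : s.Nonempty) :
    ∃ x, ⋂ j ∈ s, halfLine (r j) = halfLine x := by
  obtain ⟨k, hk, hmax⟩ := s.exists_max_image r hs
  refine ⟨r k, subset_antisymm (Set.biInter_subset_of_mem hk) (Set.subset_iInter₂ fun j hj => ?_)⟩
  exact Set.Ioi_subset_Ioi (EReal.coe_le_coe_iff.2 (hmax j hj))

theorem integral_one_sub_indicatorChar_halfLine {ι : Type*} [Fintype ι] [DecidableEq ι]
    (t r : ι → ℝ) {m : Measure UpperReal} (hm : ∀ x, m (halfLine x) ≠ ⊤) :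
    ∫ y, (1 - indicatorChar t (fun j => halfLine (r j)) y) ∂m
      = -∑ s ∈ Finset.univ.powerset.erase ∅, (m.real (⋂ j ∈ s, halfLine (r j)) : ℂ) *
        ∏ j ∈ s, (Complex.exp (t j * Complex.I) - 1) := by
  have hmeas : ∀ s : Finset ι, MeasurableSet (⋂ j ∈ s, halfLine (r j)) := fun s =>
    MeasurableSet.biInter s.countable_toSet fun j _ => measurableSet_halfLine (r j)
  simp_rw [one_sub_indicatorChar_eq_sum]
  rw [integral_neg, integral_finsetSum]
  · congr 1
    refine Finset.sum_congr rfl fun s _ => ?_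
    rw [integral_indicator_const _ (hmeas s), Complex.real_smul]
  · intro s hs
    obtain ⟨x, hx⟩ := exists_iInter_halfLine_eq r
      (Finset.nonempty_iff_ne_empty.2 (Finset.ne_of_mem_erase hs))
    exact (integrable_indicator_iff (hmeas s)).2 (integrableOn_const (by rw [hx]; exact hm x))

theorem expIntensity_real_halfLine (x : ℝ) : expIntensity.real (halfLine x) = Real.exp (-x) := by
  rw [Measure.real, halfLine, expIntensity_Ioi, ENNReal.toReal_ofReal (Real.exp_pos _).le]

theorem expIntensity_halfLine_ne_top (x : ℝ) : expIntensity (halfLine x) ≠ ⊤ := by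
  rw [halfLine, expIntensity_Ioi]
  exact ENNReal.ofReal_ne_top

theorem toUpperReal_mem_halfLine {x y : ℝ} : toUpperReal y ∈ halfLine x ↔ x < y :=
  EReal.coe_lt_coe_iff

theorem tendsto_pow_integral_indicatorChar {p : ℕ → ℕ} (hp : Tendsto p atTop atTop)
    {ν : ℕ → Measure ℝ} [∀ n, IsProbabilityMeasure (ν n)]
    (hν : ∀ x, Tendsto (fun n => (p n : ℝ) * (ν n).real (Set.Ioi x)) atTop (𝓝 (Real.exp (-x))))
    {ι : Type*} [Fintype ι] (t r : ι → ℝ) :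
    Tendsto (fun n => (∫ y, indicatorChar t (fun j => halfLine (r j)) (toUpperReal y) ∂ν n) ^ p n)
      atTop (𝓝 (Complex.exp
        (-∫ y, (1 - indicatorChar t (fun j => halfLine (r j)) y) ∂expIntensity))) := by
  classical
  have hχ : Measurable (indicatorChar t fun j => halfLine (r j)) :=
    measurable_indicatorChar t fun j => measurableSet_halfLine _
  have := fun n => Measure.isProbabilityMeasure_map (μ := ν n) measurable_toUpperReal.aemeasurable
  have hνmap : ∀ n x, ((ν n).map toUpperReal).real (halfLine x) = (ν n).real (Set.Ioi x) := by
    intro n x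
    rw [Measure.real, Measure.map_apply measurable_toUpperReal (measurableSet_halfLine x)]
    congr 2
    ext y
    exact toUpperReal_mem_halfLine
  have hone : ∀ n, ∫ y, indicatorChar t (fun j => halfLine (r j)) (toUpperReal y) ∂ν n
      = 1 + -∫ y, (1 - indicatorChar t (fun j => halfLine (r j)) y) ∂((ν n).map toUpperReal) := by
    intro n
    rw [integral_sub (integrable_const _) (Integrable.of_bound hχ.aestronglyMeasurable 1
      (Eventually.of_forall fun y => (norm_indicatorChar _ _ y).le)),
      integral_map measurable_toUpperReal.aemeasurable hχ.aestronglyMeasurable]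
    simp
  simp_rw [hone]
  refine tendsto_one_add_pow_of_tendsto_mul hp ?_
  rw [integral_one_sub_indicatorChar_halfLine t r expIntensity_halfLine_ne_top]
  simp_rw [integral_one_sub_indicatorChar_halfLine t r fun x => measure_ne_top _ (halfLine x)]
  simp_rw [neg_neg, Finset.mul_sum]
  refine tendsto_finsetSum _ fun s hs => ?_
  obtain ⟨x, hx⟩ := exists_iInter_halfLine_eq r
    (Finset.nonempty_iff_ne_empty.2 (Finset.ne_of_mem_erase hs))
  rw [hx, expIntensity_real_halfLine]
  simp_rw [hνmap, ← mul_assoc]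
  have h := (Complex.continuous_ofReal.tendsto _).comp (hν x)
  refine Tendsto.mul_const _ (h.congr fun n => ?_)
  simp

/-! ### Point processes of independent points -/

theorem sumDirac_apply_eq_sum {k : ℕ} (y : Fin k → UpperReal) {B : Set UpperReal}
    (hB : MeasurableSet B) :
    (sumDirac y).toMeasure.real B = ∑ i, B.indicator (1 : UpperReal → ℝ) (y i) := by
  rw [Measure.real, sumDirac_toMeasure_of_finite, sum_dirac_apply y hB, tsum_fintype,
    ENNReal.toReal_sum]
  · refine Finset.sum_congr rfl fun i _ => ?_
    by_cases h : y i ∈ B <;> simp [h]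
  · intro i _
    by_cases h : y i ∈ B <;> simp [h]

theorem sumDirac_halfLine_eq_zero_iff {k : ℕ} (y : Fin k → ℝ) (x : ℝ) :
    (sumDirac fun i => toUpperReal (y i)).toMeasure (halfLine x) = 0 ↔ ∀ i, y i ≤ x := by
  rw [sumDirac_toMeasure_of_finite, sum_dirac_apply _ (measurableSet_halfLine x),
    ENNReal.tsum_eq_zero]
  refine forall_congr' fun i => ?_
  rw [Set.indicator_apply_eq_zero, toUpperReal_mem_halfLine]
  simp

section Points

variable {Ω : Type*} [MeasurableSpace Ω] {P : Measure Ω}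

theorem aemeasurable_sumDirac_halfLine {k : ℕ} {Y : ℕ → Ω → ℝ} (hY : ∀ i, AEMeasurable (Y i) P)
    (x : ℝ) : AEMeasurable (fun ω => (sumDirac fun i : Fin k =>
      toUpperReal (Y i ω)).toMeasure.real (halfLine x)) P := by
  simp_rw [sumDirac_apply_eq_sum _ (measurableSet_halfLine x)]
  exact Finset.aemeasurable_fun_sum _ fun i _ =>
    ((measurable_one.indicator (measurableSet_halfLine x)).comp
      measurable_toUpperReal).comp_aemeasurable (hY i)

/-- The character of the counts is the product over the points of `indicatorChar`, and the points
are iid. -/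
theorem integral_exp_sum_sumDirac {Y : ℕ → Ω → ℝ} (hY : ∀ i, AEMeasurable (Y i) P)
    (hind : iIndepFun Y P) {ν : Measure ℝ} (hν : ∀ i, P.map (Y i) = ν) (k : ℕ)
    {ι : Type*} [Fintype ι] (t r : ι → ℝ) :
    ∫ ω, Complex.exp ((∑ j, t j * (sumDirac fun i : Fin k =>
        toUpperReal (Y i ω)).toMeasure.real (halfLine (r j)) : ℝ) * Complex.I) ∂P
      = (∫ y, indicatorChar t (fun j => halfLine (r j)) (toUpperReal y) ∂ν) ^ k := by
  have hχ : Measurable fun y => indicatorChar t (fun j => halfLine (r j)) (toUpperReal y) :=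
    (measurable_indicatorChar t fun j => measurableSet_halfLine _).comp measurable_toUpperReal
  simp_rw [sumDirac_apply_eq_sum _ (measurableSet_halfLine _), ← prod_indicatorChar]
  have hind' : iIndepFun (fun (i : Fin k) ω => indicatorChar t (fun j => halfLine (r j))
      (toUpperReal (Y i ω))) P :=
    (hind.precomp Fin.val_injective).comp (fun _ => _) fun _ => hχ
  rw [hind'.integral_fun_prod_eq_prod_integral fun i =>
    (hχ.comp_aemeasurable (hY i)).aestronglyMeasurable]
  have h : ∀ i : Fin k, ∫ ω, indicatorChar t (fun j => halfLine (r j)) (toUpperReal (Y i ω)) ∂P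
      = ∫ y, indicatorChar t (fun j => halfLine (r j)) (toUpperReal y) ∂ν := by
    intro i
    rw [← hν i, integral_map (hY i) hχ.aestronglyMeasurable]
  simp [h]

theorem measureReal_forall_le {Y : ℕ → Ω → ℝ} (hY : ∀ i, AEMeasurable (Y i) P)
    (hind : iIndepFun Y P) {ν : Measure ℝ} [IsProbabilityMeasure ν] (hν : ∀ i, P.map (Y i) = ν)
    (k : ℕ) (x : ℝ) :
    P.real {ω | ∀ i : Fin k, Y i ω ≤ x} = (1 - ν.real (Set.Ioi x)) ^ k := by
  have hind' : iIndepFun (fun i : Fin k => Y i) P := hind.precomp Fin.val_injective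
  have h := hind'.measure_inter_preimage_eq_mul Finset.univ (sets := fun _ => Set.Iic x)
    fun _ _ => measurableSet_Iic
  have hset : {ω | ∀ i : Fin k, Y i ω ≤ x} = ⋂ i ∈ (Finset.univ : Finset (Fin k)), Y i ⁻¹' Set.Iic x := by
    ext ω
    simp
  have hone : ∀ i : Fin k, P (Y i ⁻¹' Set.Iic x) = ν (Set.Iic x) := fun i => by
    rw [← hν i, Measure.map_apply_of_aemeasurable (hY i) measurableSet_Iic]
  rw [hset, Measure.real, h]
  simp only [hone, Finset.prod_const, Finset.card_univ, Fintype.card_fin, ENNReal.toReal_pow]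
  have hcompl := probReal_compl_eq_one_sub (μ := ν) (measurableSet_Ioi (a := x))
  rw [Set.compl_Ioi] at hcompl
  rw [← hcompl, Measure.real]

end Points

/-! ### Void probabilities -/

/-- With a cut-off `f` equal to `1` on `[y, ∞]` and `0` on `(-∞, x]`, take `F m = max 0 (1 - ∫ f
dm)`. A nonzero count in `(y, ∞]` is at least `1`, which forces `F m = 0`. -/
theorem exists_boundedContinuous_void {x y : ℝ} (hxy : x < y) :
    ∃ F : BoundedContinuousFunction (PointMeasure UpperReal) ℝ, (∀ m, 0 ≤ F m ∧ F m ≤ 1) ∧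
      (∀ m, m.toMeasure (halfLine x) = 0 → F m = 1) ∧
      ∀ m, m.toMeasure (halfLine y) ≠ 0 → F m = 0 := by
  obtain ⟨f, hf1, hf0, hfc, hf01⟩ := exists_continuous_one_zero_of_isCompact
    (isCompact_Ici_toUpperReal y) (isClosed_Iic (a := toUpperReal x)) (by
      refine Set.disjoint_left.2 fun z hz hz' => ?_
      exact absurd (hz.trans hz') (not_le.2 (EReal.coe_lt_coe_iff.2 hxy)))
  let g : CompactlySupportedContinuousMap UpperReal ℝ := ⟨f, hfc⟩
  have hgc : Continuous fun m : PointMeasure UpperReal => ∫ z, f z ∂m.toMeasure := by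
    have h : Continuous fun (m : PointMeasure UpperReal)
        (f : CompactlySupportedContinuousMap UpperReal ℝ) => ∫ z, f z ∂m.toMeasure :=
      continuous_induced_dom
    exact (continuous_apply g).comp h
  have hpos : ∀ m : PointMeasure UpperReal, 0 ≤ ∫ z, f z ∂m.toMeasure := fun m =>
    integral_nonneg fun z => (hf01 z).1
  have hFc : Continuous fun m : PointMeasure UpperReal => max 0 (1 - ∫ z, f z ∂m.toMeasure) :=
    continuous_const.max (continuous_const.sub hgc)
  have h01 : ∀ m : PointMeasure UpperReal, 0 ≤ max 0 (1 - ∫ z, f z ∂m.toMeasure) ∧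
      max 0 (1 - ∫ z, f z ∂m.toMeasure) ≤ 1 := fun m =>
    ⟨le_max_left _ _, max_le zero_le_one (by linarith [hpos m])⟩
  refine ⟨BoundedContinuousFunction.ofNormedAddCommGroup _ hFc 1 fun m => ?_, h01,
    fun m hm => ?_, fun m hm => ?_⟩
  · rw [Real.norm_of_nonneg (h01 m).1]
    exact (h01 m).2
  · have hint : ∫ z, f z ∂m.toMeasure = 0 := by
      refine integral_eq_zero_of_ae ?_
      filter_upwards [measure_eq_zero_iff_ae_notMem.1 hm] with z hz
      exact hf0 (Set.mem_Iic.2 (not_lt.1 hz))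
    simp [hint]
  · have : IsFiniteMeasureOnCompacts m.toMeasure := ⟨fun K hK => m.isPointMeasure.1 K hK⟩
    have hfi : Integrable f m.toMeasure := f.continuous.integrable_of_hasCompactSupport hfc
    have h1 : m.toMeasure.real (halfLine y) ≤ ∫ z, f z ∂m.toMeasure := by
      rw [← integral_indicator_one (measurableSet_halfLine y)]
      refine integral_mono ((integrable_indicator_iff (measurableSet_halfLine y)).2
        (integrableOn_const (m.measure_halfLine_ne_top y))) hfi fun z => ?_
      by_cases hz : z ∈ halfLine y
      · rw [Set.indicator_of_mem hz, hf1 (Set.mem_Ici.2 (le_of_lt hz))]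
      · rw [Set.indicator_of_notMem hz]
        exact (hf01 z).1
    obtain ⟨k, hk⟩ := m.exists_real_halfLine_eq y
    have hk0 : k ≠ 0 := by
      rintro rfl
      rw [Nat.cast_zero, measureReal_eq_zero_iff (m.measure_halfLine_ne_top y)] at hk
      exact hm hk
    have hk1 : (1 : ℝ) ≤ k := by exact_mod_cast Nat.one_le_iff_ne_zero.2 hk0
    exact max_eq_left (by linarith)

theorem measureReal_le_integral_of_eq_one {Ω : Type*} [MeasurableSpace Ω] {P : Measure Ω}
    [IsProbabilityMeasure P] {F : Ω → ℝ} (hF : Integrable F P) (h0 : ∀ ω, 0 ≤ F ω) {A : Set Ω}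
    (hA : ∀ ω ∈ A, F ω = 1) : P.real A ≤ ∫ ω, F ω ∂P := by
  have h := mul_meas_ge_le_integral_of_nonneg (Eventually.of_forall h0) hF 1
  rw [one_mul] at h
  exact (measureReal_mono fun ω hω => (hA ω hω).ge).trans h

theorem integral_le_measureReal_of_eq_zero {Ω : Type*} [MeasurableSpace Ω] {P : Measure Ω}
    [IsProbabilityMeasure P] {F : Ω → ℝ} (h01 : ∀ ω, 0 ≤ F ω ∧ F ω ≤ 1) {A : Set Ω}
    (hA : ∀ ω, ω ∉ A → F ω = 0) : ∫ ω, F ω ∂P ≤ P.real A := by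
  rw [← setIntegral_eq_integral_of_forall_compl_eq_zero hA]
  refine (le_abs_self _).trans ?_
  have h := norm_setIntegral_le_of_norm_le_const (μ := P) (s := A) (f := F) (C := 1)
    (measure_lt_top _ _) fun ω _ => by rw [Real.norm_of_nonneg (h01 ω).1]; exact (h01 ω).2
  simpa using h

/-- The void event at `x` is compared with void events at nearby `x'` on either side through the
functionals above; continuity in `x` of the limit probability closes the gap. -/
theorem tendsto_void_of_tendstoInDistribution {Ω Ω' : Type*} [MeasurableSpace Ω]
    [MeasurableSpace Ω'] {P : Measure Ω} [IsProbabilityMeasure P] {P' : Measure Ω'}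
    [IsProbabilityMeasure P'] {N : ℕ → Ω → PointMeasure UpperReal}
    {N' : Ω' → PointMeasure UpperReal} (h : TendstoInDistribution N atTop N' (fun _ => P) P')
    (hcont : Continuous fun x : ℝ => P'.real {ω | (N' ω).toMeasure (halfLine x) = 0}) (x : ℝ) :
    Tendsto (fun n => P.real {ω | (N n ω).toMeasure (halfLine x) = 0}) atTop
      (𝓝 (P'.real {ω | (N' ω).toMeasure (halfLine x) = 0})) := by
  have hlim : ∀ F : BoundedContinuousFunction (PointMeasure UpperReal) ℝ,
      Tendsto (fun n => ∫ ω, F (N n ω) ∂P) atTop (𝓝 (∫ ω, F (N' ω) ∂P')) := by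
    intro F
    have h1 := ProbabilityMeasure.tendsto_iff_forall_integral_tendsto.1 h.tendsto F
    simp only [ProbabilityMeasure.coe_mk] at h1
    rw [integral_map h.aemeasurable_limit F.continuous.measurable.aestronglyMeasurable] at h1
    simp_rw [integral_map (h.forall_aemeasurable _)
      F.continuous.measurable.aestronglyMeasurable] at h1
    exact h1
  have hFi : ∀ (F : BoundedContinuousFunction (PointMeasure UpperReal) ℝ) n,
      Integrable (fun ω => F (N n ω)) P := fun F n =>
    Integrable.of_bound (F.continuous.measurable.comp_aemeasurable
      (h.forall_aemeasurable n)).aestronglyMeasurable ‖F‖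
      (Eventually.of_forall fun ω => F.norm_coe_le_norm _)
  have hFi' : ∀ (F : BoundedContinuousFunction (PointMeasure UpperReal) ℝ),
      Integrable (fun ω => F (N' ω)) P' := fun F =>
    Integrable.of_bound (F.continuous.measurable.comp_aemeasurable
      h.aemeasurable_limit).aestronglyMeasurable ‖F‖
      (Eventually.of_forall fun ω => F.norm_coe_le_norm _)
  refine tendsto_order.2 ⟨fun b hb => ?_, fun b hb => ?_⟩
  · obtain ⟨x', hx', hbx⟩ := ((hcont.tendsto x).eventually_const_lt hb |>.filter_mono
      nhdsWithin_le_nhds |>.and (self_mem_nhdsWithin (s := Set.Iio x))).exists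
    obtain ⟨F, h01, hF1, hF0⟩ := exists_boundedContinuous_void hbx
    have h1 := measureReal_le_integral_of_eq_one (hFi' F) (fun ω => (h01 _).1)
      (A := {ω | (N' ω).toMeasure (halfLine x') = 0}) fun ω hω => hF1 _ hω
    filter_upwards [(hlim F).eventually_const_lt (hx'.trans_le h1)] with n hn
    exact hn.trans_le (integral_le_measureReal_of_eq_zero (fun ω => h01 _) fun ω hω => hF0 _ hω)
  · obtain ⟨x', hx', hbx⟩ := ((hcont.tendsto x).eventually_lt_const hb |>.filter_mono
      nhdsWithin_le_nhds |>.and (self_mem_nhdsWithin (s := Set.Ioi x))).exists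
    obtain ⟨F, h01, hF1, hF0⟩ := exists_boundedContinuous_void hbx
    have h1 := integral_le_measureReal_of_eq_zero (P := P') (F := fun ω => F (N' ω))
      (A := {ω | (N' ω).toMeasure (halfLine x') = 0}) (fun ω => h01 _) fun ω hω => hF0 _ hω
    filter_upwards [(hlim F).eventually_lt_const (h1.trans_lt hx')] with n hn
    exact (measureReal_le_integral_of_eq_one (hFi F n) (fun ω => (h01 _).1)
      fun ω hω => hF1 _ hω).trans_lt hn

theorem measureReal_limitPointProcess_halfLine_eq_zero {Ω : Type*} [MeasurableSpace Ω]
    {P : Measure Ω} [IsProbabilityMeasure P] {E : ℕ → Ω → ℝ} (hindep : iIndepFun E P)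
    (hlaw : ∀ i, HasLaw (E i) (expMeasure 1) P) (x : ℝ) :
    P.real {ω | (limitPointProcess E ω).toMeasure (halfLine x) = 0}
      = Real.exp (-Real.exp (-x)) := by
  have h := hasLaw_limitPointProcess hindep hlaw (measurableSet_halfLine x)
    (expIntensity_halfLine_ne_top x)
  have hset : {ω | (limitPointProcess E ω).toMeasure (halfLine x) = 0}
      = (fun ω => (limitPointProcess E ω).toMeasure (halfLine x)) ⁻¹' {0} := rfl
  have hpre : (Nat.cast : ℕ → ENNReal) ⁻¹' {0} = {0} := by
    ext k
    simp
  have hval : (((expIntensity (halfLine x)).toNNReal : NNReal) : ℝ) = Real.exp (-x) :=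
    expIntensity_real_halfLine x
  rw [hset, Measure.real, ← Measure.map_apply_of_aemeasurable h.aemeasurable
    (measurableSet_singleton 0), h.map_eq, Measure.map_apply (by fun_prop)
    (measurableSet_singleton 0), hpre, ← Measure.real, poissonMeasure_real_singleton, hval]
  simp

/-! ### The normalized random walks -/

/-- The normalization `s ↦ d_p (s_n / √n - d_p)` of a path `s`. -/
def normalizedWalk (p : ℕ → ℕ) (n : ℕ) (s : ℕ → ℝ) : ℝ :=
  gumbelNorm (p n) * (s n / √n - gumbelNorm (p n))

theorem measurable_normalizedWalk (p : ℕ → ℕ) (n : ℕ) : Measurable (normalizedWalk p n) := by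
  unfold normalizedWalk
  fun_prop

theorem lt_normalizedWalk_iff {p : ℕ → ℕ} {n : ℕ} (hd : 0 < gumbelNorm (p n)) (s : ℕ → ℝ) (x : ℝ) :
    x < normalizedWalk p n s ↔ s n / √n > gumbelNorm (p n) + x / gumbelNorm (p n) := by
  rw [normalizedWalk, ← div_lt_iff₀' hd, lt_sub_iff_add_lt']

section Walk

variable {Ω : Type*} [MeasurableSpace Ω] {P : Measure Ω} {X : ℕ → Ω → ℝ} {p : ℕ → ℕ}

/-- The Gaussian limit holds in any case and is nonzero, so asymptotic equivalence amounts to having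
the same limit. -/
theorem tailRelation_iff (hp : Tendsto p atTop atTop)
    (hX : AEMeasurable (fun ω n => partialSum X n ω) P) :
    TailRelation P X p ↔ ∀ x, Tendsto (fun n => (p n : ℝ) *
      (P.map fun ω => normalizedWalk p n fun k => partialSum X k ω).real (Set.Ioi x)) atTop
        (𝓝 (Real.exp (-x))) := by
  refine forall_congr' fun x => ?_
  have hnt := tendsto_mul_normalTail hp x
  have hev : (fun n => (p n : ℝ) * P.real {ω | partialSum X n ω / √n
      > gumbelNorm (p n) + x / gumbelNorm (p n)}) =ᶠ[atTop] fun n => (p n : ℝ) *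
      (P.map fun ω => normalizedWalk p n fun k => partialSum X k ω).real (Set.Ioi x) := by
    filter_upwards [(tendsto_gumbelNorm hp).eventually_gt_atTop 0] with n hn
    have hm : AEMeasurable (fun ω => normalizedWalk p n fun k => partialSum X k ω) P :=
      (measurable_normalizedWalk p n).comp_aemeasurable hX
    rw [Measure.real, Measure.real, Measure.map_apply_of_aemeasurable hm measurableSet_Ioi]
    congr 3
    ext ω
    exact (lt_normalizedWalk_iff hn (fun k => partialSum X k ω) x).symm
  rw [← tendsto_congr' hev, and_iff_left hnt]
  constructor
  · exact fun h => h.symm.tendsto_nhds hnt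
  · intro h
    exact ((Asymptotics.isEquivalent_const_iff_tendsto (Real.exp_ne_zero _)).2 h).trans
      ((Asymptotics.isEquivalent_const_iff_tendsto (Real.exp_ne_zero _)).2 hnt).symm

end Walk

theorem maxConvergesToGumbel_iff {Ω : Type*} [MeasurableSpace Ω] {P : Measure Ω}
    {S : ℕ → ℕ → Ω → ℝ} {p : ℕ → ℕ} (hp : Tendsto p atTop atTop) :
    MaxConvergesToGumbel P S p ↔ ∀ x, Tendsto (fun n => P.real {ω | ∀ i : Fin (p n),
      normalizedWalk p n (fun k => S i k ω) ≤ x}) atTop (𝓝 (Real.exp (-Real.exp (-x)))) := by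
  refine forall_congr' fun x => tendsto_congr' ?_
  filter_upwards [(tendsto_gumbelNorm hp).eventually_gt_atTop 0, hp.eventually_gt_atTop 0]
    with n hn hpn
  -- This excludes the empty supremum, whose default value is `0`.
  have : Nonempty (Fin (p n)) := ⟨⟨0, hpn⟩⟩
  congr 1
  ext ω
  rw [Set.mem_ofPred_eq, Set.mem_ofPred_eq, Real.mul_iSup_of_nonneg hn.le,
    ciSup_le_iff (Set.finite_range _).bddAbove]
  rfl

theorem walkPointProcess_eq {Ω : Type*} (S : ℕ → ℕ → Ω → ℝ) (p : ℕ → ℕ) (n : ℕ) (ω : Ω) :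
    walkPointProcess S p n ω = sumDirac fun i : Fin (p n) =>
      toUpperReal (normalizedWalk p n fun k => S i k ω) := rfl

end

/-! ### Equivalence of the three limit relations -/

theorem mainTheorem4
    {Ω Ω' Ω'' : Type*} [MeasurableSpace Ω] [MeasurableSpace Ω'] [MeasurableSpace Ω'']
    (P : Measure Ω) [IsProbabilityMeasure P]
    (P' : Measure Ω') [IsProbabilityMeasure P']
    (P'' : Measure Ω'') [IsProbabilityMeasure P'']
    -- an iid sequence with mean zero and unit variance
    (X : ℕ → Ω → ℝ)
    (hX_indep : iIndepFun X P)
    (hX_ident : ∀ t, IdentDistrib (X t) (X 0) P P)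
    (hX_mean : ∫ ω, X 0 ω ∂P = 0)
    (hX_var : ∫ ω, (X 0 ω) ^ 2 ∂P = 1)
    -- iid copies of the random walk
    (S : ℕ → ℕ → Ω' → ℝ)
    (hS_indep : iIndepFun (fun i ω n => S i n ω) P')
    (hS_ident : ∀ i, IdentDistrib (fun ω n => S i n ω) (fun ω n => partialSum X n ω) P' P)
    -- iid standard exponential random variables
    (E : ℕ → Ω'' → ℝ)
    (hE_indep : iIndepFun E P'')
    (hE_law : ∀ i, HasLaw (E i) (expMeasure 1) P'')
    (p : ℕ → ℕ) (hp : Tendsto p atTop atTop) :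
    (TailRelation P X p ↔ MaxConvergesToGumbel P' S p) ∧
    (TailRelation P X p ↔
      TendstoInDistribution (walkPointProcess S p) atTop (limitPointProcess E)
        (fun _ => P') P'') ∧
    IsPoissonRandomMeasure (limitPointProcess E) expIntensity P'' := by
  have hXm : AEMeasurable (fun ω n => partialSum X n ω) P := (hS_ident 0).aemeasurable_snd
  let ν : ℕ → Measure ℝ := fun n => P.map fun ω => normalizedWalk p n fun k => partialSum X k ω
  have hνp : ∀ n, IsProbabilityMeasure (ν n) := fun n =>
    Measure.isProbabilityMeasure_map ((measurable_normalizedWalk p n).comp_aemeasurable hXm)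
  let Y : ℕ → ℕ → Ω' → ℝ := fun n i ω => normalizedWalk p n fun k => S i k ω
  have hYm : ∀ n i, AEMeasurable (Y n i) P' := fun n i =>
    (measurable_normalizedWalk p n).comp_aemeasurable (hS_ident i).aemeasurable_fst
  have hYind : ∀ n, iIndepFun (Y n) P' := fun n =>
    hS_indep.comp (fun _ => normalizedWalk p n) fun _ => measurable_normalizedWalk p n
  have hYlaw : ∀ n i, P'.map (Y n i) = ν n := fun n i =>
    ((hS_ident i).comp (measurable_normalizedWalk p n)).map_eq
  have hPoisson := isPoissonRandomMeasure_limitPointProcess hE_indep hE_law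
  have hac : TailRelation P X p → TendstoInDistribution (walkPointProcess S p) atTop
      (limitPointProcess E) (fun _ => P') P'' := by
    intro h
    rw [tailRelation_iff hp hXm] at h
    refine tendstoInDistribution_of_tendsto_halfLine
      (fun n r => aemeasurable_sumDirac_halfLine (hYm n) r)
      (fun r => aemeasurable_limitPointProcess_real hE_indep hE_law (measurableSet_halfLine r))
      fun j r t => ?_
    rw [integral_exp_sum_limitPointProcess hE_indep hE_law t
      (fun i => measurableSet_halfLine (r i)) fun i => expIntensity_halfLine_ne_top (r i)]
    refine (tendsto_pow_integral_indicatorChar (ν := ν) hp h t r).congr fun n => ?_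
    exact (integral_exp_sum_sumDirac (hYm n) (hYind n) (hYlaw n) (p n) t r).symm
  have hcb : TendstoInDistribution (walkPointProcess S p) atTop (limitPointProcess E)
      (fun _ => P') P'' → MaxConvergesToGumbel P' S p := by
    intro h
    rw [maxConvergesToGumbel_iff hp]
    intro x
    have hvoid := measureReal_limitPointProcess_halfLine_eq_zero hE_indep hE_law
    have h1 := tendsto_void_of_tendstoInDistribution h (by simp_rw [hvoid]; fun_prop) x
    simp_rw [hvoid, walkPointProcess_eq, sumDirac_halfLine_eq_zero_iff] at h1
    exact h1
  have hba : MaxConvergesToGumbel P' S p → TailRelation P X p := by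
    intro h
    rw [maxConvergesToGumbel_iff hp] at h
    rw [tailRelation_iff hp hXm]
    intro x
    refine tendsto_mul_of_tendsto_one_sub_pow hp (fun n => measureReal_le_one) ?_
    refine (h x).congr fun n => ?_
    exact measureReal_forall_le (hYm n) (hYind n) (hYlaw n) (p n) x
  exact ⟨⟨fun h => hcb (hac h), hba⟩, ⟨hac, fun h => hba (hcb h)⟩, hPoisson⟩
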